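/- **Setting.** Let $H, U_1, U_2, W$ be real Hilbert spaces, $A:\mathcal D(A)\to H$ a positive self-adjoint operator with compact inverse, and $V=\mathcal D(A^{1/2})$ with $\|u\|_V=\|A^{1/2}u\|_H$; $H$ is identified with a subspace of $V'$. Let $\tau>0$, let $0=t_0<t_1<t_2<\dots$, and let $I_n=[t_n,t_{n+1})$. Assume that the even intervals have constant length $t_{2n+1}-t_{2n}=T^*\ge\tau$ and the odd intervals have constant length $t_{2n+2}-t_{2n+1}=\tilde T\le\tau$, for all $n\in\mathbb N=\{0,1,2,\dots\}$. Let $B_1(t)\in\mathcal L(U_1,V')$, with adjoint $B_1^*(t)\in\mathcal L(V,U_1)$, and $B_2(t)\in\mathcal L(U_2,H)$ be such that, for every $n$, $B_2=0$ on $I_{2n}$, $B_1=0$ on $I_{2n+1}$, the restriction of $B_2$ to $I_{2n+1}$ extends to an element of $C([t_{2n+1},t_{2n+2}];\mathcal L(U_2,H))$, and on $I_{2n}$ either $B_1$ extends to an element of $C^1([t_{2n},t_{2n+1}];\mathcal L(U_1,H))$, or $B_1(t)=\sqrt{b_1(t)}\,C_n$ with $C_n\in\mathcal L(U_1,V')$,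 $b_1\in W^{2,\infty}(t_{2n},t_{2n+1})$ and $b_1>0$ on $I_{2n}$. Assume that $H$ embeds into $W$ and $V$ embeds into $U_1$ through continuous linear maps (suppressed in the notation; they need not be injective), with $\|u\|_W^2\le C\|u\|_H^2$ for all $u\in H$, $C>0$, and that there are positive constants $m_{2n}\le M_{2n}$ and $M_{2n+1}$ such that for all $n$ * i) $m_{2n}\|u\|_{U_1}^2\le\|B_1^*(t)u\|_{U_1}^2\le M_{2n}\|u\|_{U_1}^2$ for all $t\in I_{2n}$, $u\in V$; * ii) $\|B_2^*(t)u\|_{U_2}^2\le M_{2n+1}\|u\|_W^2$ for all $t\in I_{2n+1}$, $u\in H$. Write $E_S(t)=E_S(u,t)=\frac12\big(\|u(t)\|_V^2+\|u_t(t)\|_H^2\big)$. Consider the delayed problem $$u_{tt}(t)+Au(t)+B_1(t)B_1^*(t)u_t(t)+B_2(t)B_2^*(t)u_t(t-\tau)=0,\quad t>0,\qquad u(0)=u_0\in V,\ u_t(0)=u_1\in H,\tag{P}$$ and, for each $n$, the damped problem without delay $$w_{tt}+Aw+B_1(t)B_1^*(t)w_t=0\ \text{ on }(t_{2n},t_{2n+1}),\qquad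 w(t_{2n})=w_0^n\in V,\ w_t(t_{2n})=w_1^n\in H.\tag{D$_n$}$$ Solutions are weak solutions: functions in $C([0,\infty);V)\cap C^1([0,\infty);H)$ (respectively on $[t_{2n},t_{2n+1}]$) for which, on each $(t_{2n},t_{2n+1})$, the output $B_1^*u_t$ exists in $L^2(t_{2n},t_{2n+1};U_1)$ as the strong $L^2$ limit of $t\mapsto B_1^*(t)\frac{u(t+h)-u(t)}h$ as $h\to0^+$ (on $(t_{2n},t_{2n+1}-h)$), and which satisfy the equation in $V'$, integrated in time. (As $B_2=0$ on $[0,\tau)$, no values of $u_t$ at negative times are needed.) **Observability.** Assume that for every $n$ there is a time $\overline T_n\in[0,T^*)$ such that for every $T\in(\overline T_n,T^*]$ there is a constant $d_n=d_n(T)\ge0$, independent of the initial data, with $$E_S(w,t_{2n}+T)\le d_n(T)\int_{t_{2n}}^{t_{2n}+T}\|B_1^*(t)w_t(t)\|_{U_1}^2\,dt$$ for every weak solution $w$ of (D$_n$). Put $\hat d_n=\dfrac{d_n(T^*)}{d_n(T^*)+1}$. **Theorem.** If $$\sup_{n\in\mathbb N}\Big[e^{CM_{2n+1}\tilde T}(\hat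 d_n+1)-1\Big]<1,$$ then there exist constants $\hat\gamma,\hat\mu>0$ such that $$E_S(u,t)\le\hat\gamma e^{-\hat\mu t}E_S(u,0),\qquad t>0,$$ for every solution $u$ of (P) (for all initial data $(u_0,u_1)\in V\times H$). -/

import Mathlib

open MeasureTheory Set Filter Topology
open scoped InnerProductSpace RealInnerProductSpace NNReal LinearPMap

noncomputable section

namespace DelayDamping

/-! ### The operator `A`, its square root and the space `V = D(A^{1/2})` -/

section Operator

variable {H : Type*} [NormedAddCommGroup H] [InnerProductSpace ℝ H] [CompleteSpace H]

/-- A (densely defined) positive self-adjoint operator `A : D(A) → H` with a compact inverse. -/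
structure PosOp (H : Type*) [NormedAddCommGroup H] [InnerProductSpace ℝ H]
    [CompleteSpace H] where
  op : H →ₗ.[ℝ] H
  selfAdjoint : IsSelfAdjoint op
  positive : ∀ x : op.domain, x ≠ 0 → 0 < ⟪op x, (x : H)⟫
  compactInverse : ∃ G : H →L[ℝ] H, IsCompactOperator G ∧
    (∀ y : H, ∃ h : G y ∈ op.domain, op ⟨G y, h⟩ = y) ∧ (∀ x : op.domain, G (op x) = x)

/-- `R` is a positive self-adjoint square root of `A`: `R ∘ R = A`, domains included. -/
def IsSqrt (R A : H →ₗ.[ℝ] H) : Prop :=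
  IsSelfAdjoint R ∧ (∀ x : R.domain, 0 ≤ ⟪R x, (x : H)⟫) ∧
    ∀ x y : H, (x, y) ∈ A.graph ↔ ∃ z : H, (x, z) ∈ R.graph ∧ (z, y) ∈ R.graph

/-- A compact positive symmetric operator has a positive symmetric square root. -/
theorem exists_bounded_sqrt (G : H →L[ℝ] H) (hc : IsCompactOperator G)
    (hs : ∀ x y : H, ⟪G x, y⟫ = ⟪x, G y⟫) (hp : ∀ x : H, 0 ≤ ⟪G x, x⟫) :
    ∃ S : H →L[ℝ] H, (∀ x y : H, ⟪S x, y⟫ = ⟪x, S y⟫) ∧ (∀ x : H, 0 ≤ ⟪S x, x⟫) ∧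
      ∀ x : H, S (S x) = G x := by
  classical
  have hsym : (G : H →ₗ[ℝ] H).IsSymmetric := fun x y => hs x y
  let E : ℝ → Submodule ℝ H := fun μ => Module.End.eigenspace (G : H →ₗ[ℝ] H) μ
  have hE : ∀ μ (x : E μ), G x = μ • (x : H) := fun μ x => Module.End.mem_eigenspace_iff.1 x.2
  have hcl : ∀ μ, IsClosed (E μ : Set H) := by
    intro μ
    have : (E μ : Set H) = {x | G x = μ • x} := by
      ext x; exact Module.End.mem_eigenspace_iff
    rw [this]
    exact isClosed_eq G.continuous (continuous_const_smul μ)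
  have : ∀ μ, CompleteSpace (E μ) := fun μ => (hcl μ).completeSpace_coe
  have hort := hsym.orthogonalFamily_eigenspaces
  have htot : (⨆ μ, E μ)ᗮ = ⊥ :=
    ContinuousLinearMap.orthogonalComplement_iSup_eigenspaces_eq_bot hc hsym
  have hsum : IsHilbertSum ℝ (fun μ => E μ) (fun μ => (E μ).subtypeₗᵢ) := by
    refine IsHilbertSum.mkInternal _ hort ?_
    rw [← Submodule.orthogonal_orthogonal_eq_closure, htot, Submodule.bot_orthogonal_eq_top]
  let e := hsum.linearIsometryEquiv
  have hbound : ∀ μ (x : E μ), ‖√μ • x‖ ≤ √‖G‖ * ‖x‖ := by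
    intro μ x
    rw [norm_smul, Real.norm_of_nonneg (Real.sqrt_nonneg _)]
    rcases eq_or_ne x 0 with rfl | hx
    · simp
    · gcongr
      have h1 : 0 < ‖(x : H)‖ := by simpa using hx
      have h2 : ‖μ • (x : H)‖ ≤ ‖G‖ * ‖(x : H)‖ := by
        rw [← hE]; exact G.le_opNorm _
      rw [norm_smul] at h2
      exact (le_abs_self μ).trans (le_of_mul_le_mul_right h2 h1)
  have hnn : ∀ μ (x : E μ), x ≠ 0 → 0 ≤ μ := by
    intro μ x hx
    have h1 := hp x
    rw [hE, real_inner_smul_left, real_inner_self_eq_norm_sq] at h1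
    have h2 : 0 < ‖(x : H)‖ ^ 2 := by
      have : 0 < ‖(x : H)‖ := by simpa using hx
      positivity
    exact nonneg_of_mul_nonneg_left h1 h2
  have hmem : ∀ f : lp (fun μ => E μ) 2, Memℓp (fun μ => √μ • f μ) 2 := by
    intro f
    refine memℓp_gen ?_
    have h1 := (lp.memℓp f).summable (by norm_num)
    refine Summable.of_nonneg_of_le (fun μ => by positivity) (fun μ => ?_)
      (h1.mul_left ((√‖G‖) ^ (2 : ENNReal).toReal))
    rw [← Real.mul_rpow (by positivity) (by positivity)]
    exact Real.rpow_le_rpow (by positivity) (hbound μ _) (by norm_num)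
  let D0 : lp (fun μ => E μ) 2 →ₗ[ℝ] lp (fun μ => E μ) 2 :=
    { toFun := fun f => ⟨fun μ => √μ • f μ, hmem f⟩
      map_add' := fun f g => by
        ext μ
        exact congrArg Subtype.val (smul_add (√μ) (f μ) (g μ))
      map_smul' := fun c f => by
        ext μ
        simp only [lp.coeFn_smul, Pi.smul_apply, RingHom.id_apply]
        rw [smul_comm] }
  have hD0 : ∀ f μ, (D0 f) μ = √μ • f μ := fun f μ => rfl
  let D : lp (fun μ => E μ) 2 →L[ℝ] lp (fun μ => E μ) 2 := D0.mkContinuous (√‖G‖) (by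
    intro f
    have hp2 : 0 < (2 : ENNReal).toReal := by norm_num
    refine lp.norm_le_of_forall_sum_le hp2 (by positivity) (fun s => ?_)
    rw [Real.mul_rpow (by positivity) (by positivity)]
    calc ∑ μ ∈ s, ‖D0 f μ‖ ^ (2 : ENNReal).toReal
        ≤ ∑ μ ∈ s, (√‖G‖) ^ (2 : ENNReal).toReal * ‖f μ‖ ^ (2 : ENNReal).toReal := by
          refine Finset.sum_le_sum fun μ _ => ?_
          rw [← Real.mul_rpow (by positivity) (by positivity)]
          exact Real.rpow_le_rpow (by positivity) (hbound μ _) (by norm_num)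
      _ = (√‖G‖) ^ (2 : ENNReal).toReal * ∑ μ ∈ s, ‖f μ‖ ^ (2 : ENNReal).toReal := by
          rw [Finset.mul_sum]
      _ ≤ _ := by
          gcongr
          exact lp.sum_rpow_le_norm_rpow hp2 f s)
  have hD : ∀ f μ, (D f) μ = √μ • f μ := fun f μ => rfl
  have hDG : ∀ f, e.symm (D (D f)) = G (e.symm f) := by
    intro f
    have h1 := (hsum.hasSum_linearIsometryEquiv_symm f).mapL G
    have h2 := hsum.hasSum_linearIsometryEquiv_symm (D (D f))
    refine h2.unique ?_
    convert h1 using 2 with μ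
    change ((D (D f) μ : E μ) : H) = G (f μ : H)
    rw [hE, hD, hD]
    rcases eq_or_ne (f μ) 0 with h0 | h0
    · simp [h0]
    · rw [smul_smul, Real.mul_self_sqrt (hnn μ _ h0)]
      rfl
  refine ⟨(e.symm.toContinuousLinearEquiv : _ →L[ℝ] H) ∘L D ∘L
    (e.toContinuousLinearEquiv : H →L[ℝ] _), ?_, ?_, ?_⟩
  · intro x y
    have h1 : ∀ a b, ⟪D a, b⟫ = ⟪a, D b⟫ := by
      intro a b
      rw [lp.inner_eq_tsum, lp.inner_eq_tsum]
      congr 1; ext μ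
      rw [hD, hD, real_inner_smul_left, real_inner_smul_right]
    have h2 := h1 (e x) (e y)
    rw [← e.symm.inner_map_map, ← e.symm.inner_map_map (e x)] at h2
    simpa using h2
  · intro x
    have h1 : 0 ≤ ⟪D (e x), e x⟫ := by
      rw [lp.inner_eq_tsum]
      refine tsum_nonneg fun μ => ?_
      rw [hD, real_inner_smul_left]
      exact mul_nonneg (Real.sqrt_nonneg _) real_inner_self_nonneg
    rw [← e.symm.inner_map_map] at h1
    simpa using h1
  · intro x
    have := hDG (e x)
    simpa using this

/-- Every positive self-adjoint operator with a compact inverse has a square root. -/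
theorem PosOp.exists_sqrt (A : PosOp H) : ∃ R : H →ₗ.[ℝ] H, IsSqrt R A.op := by
  obtain ⟨G, hGc, hG1, hG2⟩ := A.compactInverse
  have hAs : ∀ x y : A.op.domain, ⟪A.op x, (y : H)⟫ = ⟪(x : H), A.op y⟫ := by
    intro x y
    have h := LinearPMap.adjoint_isFormalAdjoint (T := A.op) A.selfAdjoint.dense_domain
    rw [LinearPMap.isSelfAdjoint_def.1 A.selfAdjoint] at h
    exact h x y
  have hpos : ∀ x : A.op.domain, 0 ≤ ⟪A.op x, (x : H)⟫ := by
    intro x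
    rcases eq_or_ne x 0 with rfl | hx
    · simp
    · exact (A.positive x hx).le
  obtain ⟨S, hS1, hS2, hS3⟩ := exists_bounded_sqrt G hGc
    (by
      intro x y
      obtain ⟨hx, hx'⟩ := hG1 x
      obtain ⟨hy, hy'⟩ := hG1 y
      have := hAs ⟨G x, hx⟩ ⟨G y, hy⟩
      rw [hx', hy'] at this
      exact this.symm)
    (by
      intro x
      obtain ⟨hx, hx'⟩ := hG1 x
      have := hpos ⟨G x, hx⟩
      rw [hx', real_inner_comm] at this
      exact this)
  have hGi : ∀ x, G x = 0 → x = 0 := by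
    intro x hx
    obtain ⟨h, h'⟩ := hG1 x
    have h0 : (⟨G x, h⟩ : A.op.domain) = 0 := Subtype.ext hx
    rw [← h', h0]
    exact A.op.toFun.map_zero
  have hSi : ∀ x, S x = 0 → x = 0 := fun x hx => hGi x (by rw [← hS3, hx, map_zero])
  have hSinj : Function.Injective S := (injective_iff_map_eq_zero S).2 hSi
  let eS : H ≃ₗ[ℝ] LinearMap.range (S : H →ₗ[ℝ] H) := LinearEquiv.ofInjective (S : H →ₗ[ℝ] H) hSinj
  let R : H →ₗ.[ℝ] H := ⟨LinearMap.range (S : H →ₗ[ℝ] H), eS.symm.toLinearMap⟩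
  have hRg : ∀ x y, (x, y) ∈ R.graph ↔ S y = x := by
    intro x y
    rw [LinearPMap.mem_graph_iff]
    constructor
    · rintro ⟨z, rfl, rfl⟩
      have : eS (eS.symm z) = z := eS.apply_symm_apply z
      exact congrArg Subtype.val this
    · rintro rfl
      exact ⟨eS y, rfl, eS.symm_apply_apply y⟩
  have hRS : ∀ y : H, R (eS y) = y := fun y => eS.symm_apply_apply y
  have hSR : ∀ x : R.domain, S (R x) = x := fun x => (hRg _ _).1 (R.mem_graph x)
  have hdense : Dense (R.domain : Set H) := by
    have : R.domainᗮ = ⊥ := by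
      rw [eq_bot_iff]
      intro y hy
      refine hSi y ?_
      have h := (Submodule.mem_orthogonal _ _).1 hy (S (S y)) ⟨S y, rfl⟩
      rw [hS1] at h
      exact inner_self_eq_zero.1 h
    exact (Submodule.dense_iff_topologicalClosure_eq_top).2
      ((Submodule.topologicalClosure_eq_top_iff).2 this)
  refine ⟨R, ?_, ?_, ?_⟩
  · rw [LinearPMap.isSelfAdjoint_def]
    have hadj : ∀ x : R†.domain, S (R† x) = x := by
      intro x
      refine ext_inner_right ℝ fun h => ?_
      have := LinearPMap.adjoint_isFormalAdjoint hdense x (eS h)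
      rw [hRS] at this
      exact (hS1 _ _).trans this
    refine le_antisymm ?_ ?_
    · refine ⟨fun y hy => ⟨R† ⟨y, hy⟩, hadj ⟨y, hy⟩⟩, fun x y hxy => ?_⟩
      exact hSinj (by rw [hadj, hSR, hxy])
    · refine LinearPMap.IsFormalAdjoint.le_adjoint hdense ?_
      intro x y
      calc ⟪R x, (y : H)⟫ = ⟪R x, S (R y)⟫ := by rw [hSR]
        _ = ⟪S (R x), R y⟫ := (hS1 _ _).symm
        _ = ⟪(x : H), R y⟫ := by rw [hSR]
  · intro x
    have := hS2 (R x)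
    rwa [hSR, real_inner_comm] at this
  · intro x y
    simp only [hRg]
    rw [LinearPMap.mem_graph_iff]
    constructor
    · rintro ⟨z, rfl, rfl⟩
      exact ⟨S (A.op z), by rw [hS3, hG2], rfl⟩
    · rintro ⟨z, rfl, rfl⟩
      rw [hS3]
      obtain ⟨h, h'⟩ := hG1 y
      exact ⟨⟨G y, h⟩, rfl, h'⟩

/-- The operator `A^{1/2}`. (The positive self-adjoint square root is unique.) -/
def PosOp.sqrt (A : PosOp H) : H →ₗ.[ℝ] H := A.exists_sqrt.choose

theorem PosOp.sqrt_spec (A : PosOp H) : IsSqrt A.sqrt A.op := A.exists_sqrt.choose_spec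

/-- The space `V = D(A^{1/2})`, with the inner product `⟪u, v⟫_V = ⟪A^{1/2} u, A^{1/2} v⟫_H`. -/
def PosOp.V (A : PosOp H) : Type _ := A.sqrt.domain

instance (A : PosOp H) : AddCommGroup A.V := inferInstanceAs (AddCommGroup A.sqrt.domain)

instance (A : PosOp H) : Module ℝ A.V := inferInstanceAs (Module ℝ A.sqrt.domain)

/-- The inclusion `V ⊆ H`, as a linear map. -/
def PosOp.inclLin (A : PosOp H) : A.V →ₗ[ℝ] H := A.sqrt.domain.subtype

/-- `A^{1/2}` as a linear map `V → H`. -/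
def PosOp.sqrtV (A : PosOp H) : A.V →ₗ[ℝ] H := A.sqrt.toFun

theorem PosOp.norm_incl_le (A : PosOp H) :
    ∃ c : ℝ, ∀ u : A.V, ‖A.inclLin u‖ ≤ c * ‖A.sqrtV u‖ := by
  obtain ⟨G, -, hG1, -⟩ := A.compactInverse
  obtain ⟨hR1, -, hR3⟩ := A.sqrt_spec
  have hsym : ∀ x y : A.V, ⟪A.sqrtV x, A.inclLin y⟫ = ⟪A.inclLin x, A.sqrtV y⟫ := by
    intro x y
    have h := LinearPMap.adjoint_isFormalAdjoint (T := A.sqrt) hR1.dense_domain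
    rw [LinearPMap.isSelfAdjoint_def.1 hR1] at h
    exact h x y
  refine ⟨√‖G‖, fun u => ?_⟩
  obtain ⟨hx, hx'⟩ := hG1 (A.inclLin u)
  have h1 : (G (A.inclLin u), A.inclLin u) ∈ A.op.graph :=
    (LinearPMap.mem_graph_iff _).2 ⟨⟨_, hx⟩, rfl, hx'⟩
  obtain ⟨z, hz1, hz2⟩ := (hR3 _ _).1 h1
  obtain ⟨p, hp1, hp2⟩ := (LinearPMap.mem_graph_iff _).1 hz1
  obtain ⟨q, hq1, hq2⟩ := (LinearPMap.mem_graph_iff _).1 hz2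
  let p' : A.V := p
  let q' : A.V := q
  have hp1 : A.inclLin p' = G (A.inclLin u) := hp1
  have hp2 : A.sqrtV p' = z := hp2
  have hq1 : A.inclLin q' = z := hq1
  have hq2 : A.sqrtV q' = A.inclLin u := hq2
  have e1 : ‖A.inclLin u‖ ^ 2 = ⟪A.sqrtV u, z⟫ := by
    rw [← real_inner_self_eq_norm_sq]
    nth_rewrite 2 [← hq2]
    rw [← hsym, hq1]
  have e2 : ‖z‖ ^ 2 = ⟪A.inclLin u, G (A.inclLin u)⟫ := by
    rw [← real_inner_self_eq_norm_sq, ← hp1, ← hq2, hsym, hq1, hp2]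
  have e3 : ‖z‖ ≤ √‖G‖ * ‖A.inclLin u‖ := by
    refine (sq_le_sq₀ (norm_nonneg _) (by positivity)).1 ?_
    rw [e2, mul_pow, Real.sq_sqrt (norm_nonneg _)]
    calc ⟪A.inclLin u, G (A.inclLin u)⟫ ≤ ‖A.inclLin u‖ * ‖G (A.inclLin u)‖ :=
          real_inner_le_norm _ _
      _ ≤ ‖A.inclLin u‖ * (‖G‖ * ‖A.inclLin u‖) := by gcongr; exact G.le_opNorm _
      _ = _ := by ring
  rcases eq_or_lt_of_le (norm_nonneg (A.inclLin u)) with h0 | h0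
  · rw [← h0]; positivity
  · have h4 : ‖A.inclLin u‖ * ‖A.inclLin u‖ ≤ √‖G‖ * ‖A.sqrtV u‖ * ‖A.inclLin u‖ := by
      calc ‖A.inclLin u‖ * ‖A.inclLin u‖ = ⟪A.sqrtV u, z⟫ := by rw [← e1]; ring
        _ ≤ ‖A.sqrtV u‖ * ‖z‖ := real_inner_le_norm _ _
        _ ≤ ‖A.sqrtV u‖ * (√‖G‖ * ‖A.inclLin u‖) := by gcongr
        _ = _ := by ring
    exact le_of_mul_le_mul_right h4 h0

/-- The inner product of `V`. -/
@[reducible] def PosOp.core (A : PosOp H) : InnerProductSpace.Core ℝ A.V where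
  inner u v := ⟪A.sqrtV u, A.sqrtV v⟫
  conj_inner_symm u v := real_inner_comm _ _
  re_inner_nonneg u := real_inner_self_nonneg
  add_left u v w := by simp only [map_add, inner_add_left]
  smul_left u v c := by simp only [map_smul, real_inner_smul_left]; rfl
  definite u hu := by
    obtain ⟨c, hc⟩ := A.norm_incl_le
    have h1 := hc u
    rw [inner_self_eq_zero.1 hu, norm_zero, mul_zero] at h1
    exact Subtype.ext (norm_le_zero_iff.1 h1)

instance (A : PosOp H) : NormedAddCommGroup A.V := A.core.toNormedAddCommGroup

instance (A : PosOp H) : InnerProductSpace ℝ A.V := InnerProductSpace.ofCore A.core.toCore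

theorem PosOp.inner_V (A : PosOp H) (u v : A.V) : ⟪u, v⟫ = ⟪A.sqrtV u, A.sqrtV v⟫ := rfl

theorem PosOp.norm_V (A : PosOp H) (u : A.V) : ‖u‖ = ‖A.sqrtV u‖ := by
  rw [norm_eq_sqrt_real_inner, PosOp.inner_V, norm_eq_sqrt_real_inner]

/-- The continuous inclusion `V → H`. -/
def PosOp.incl (A : PosOp H) : A.V →L[ℝ] H :=
  A.inclLin.mkContinuousOfExistsBound (by
    obtain ⟨c, hc⟩ := A.norm_incl_le
    exact ⟨c, fun u => by rw [A.norm_V]; exact hc u⟩)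

/-- The inclusion `H → V'` (`H` being the pivot space): `h ↦ ⟪h, ·⟫_H`. -/
def PosOp.pivot (A : PosOp H) : H →L[ℝ] StrongDual ℝ A.V :=
  ((ContinuousLinearMap.compL ℝ A.V H ℝ).flip A.incl) ∘L innerSL ℝ

theorem PosOp.pivot_apply (A : PosOp H) (h : H) (v : A.V) : A.pivot h v = ⟪h, A.incl v⟫ := rfl

/-- The standard energy `E_S = (‖u‖_V² + ‖u_t‖_H²) / 2` of the state `(u, u_t)`. -/
def PosOp.energy (A : PosOp H) (u : A.V) (v : H) : ℝ := (‖u‖ ^ 2 + ‖v‖ ^ 2) / 2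

end Operator

/-! ### The damping operators -/

section Damping

variable {H : Type*} [NormedAddCommGroup H] [InnerProductSpace ℝ H] [CompleteSpace H]
  {U₁ : Type*} [NormedAddCommGroup U₁] [InnerProductSpace ℝ U₁] [CompleteSpace U₁]
  {U₂ : Type*} [NormedAddCommGroup U₂] [InnerProductSpace ℝ U₂] [CompleteSpace U₂]

/-- The adjoint `B* : V → U₁` of `B : U₁ → V'`: `⟪B* v, x⟫_{U₁} = ⟨B x, v⟩_{V', V}`. -/
def dualOp {A : PosOp H} (B : U₁ →L[ℝ] StrongDual ℝ A.V) : A.V →L[ℝ] U₁ :=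
  LinearMap.mkContinuous
    { toFun := fun v => (InnerProductSpace.toDual ℝ U₁).symm (B.flip v)
      map_add' := fun v w => by simp only [map_add]
      map_smul' := fun c v => by
        rw [map_smul, LinearIsometryEquiv.map_smulₛₗ]
        rfl }
    ‖B.flip‖ (fun v => by
      simpa using B.flip.le_opNorm v)

theorem dualOp_inner {A : PosOp H} (B : U₁ →L[ℝ] StrongDual ℝ A.V) (v : A.V) (x : U₁) :
    ⟪dualOp B v, x⟫ = B x v :=
  InnerProductSpace.toDual_symm_apply (𝕜 := ℝ)

/-- `β ∈ W^{2,∞}(a, b)`, for the continuous representative of `β` on `[a, b]`: `β` has a Lipschitz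
derivative. -/
def IsW2Infty (β : ℝ → ℝ) (a b : ℝ) : Prop :=
  ∃ (β' : ℝ → ℝ) (K : ℝ≥0), (∀ s ∈ Icc a b, HasDerivWithinAt β (β' s) (Icc a b) s) ∧
    LipschitzOnWith K β' (Icc a b)

/-- Time regularity of the undelayed damping operator on `[a, b)`: either it is bounded and
`B₁ ∈ C¹([a, b]; L(U₁, H))`, or `B₁(s) = √(β(s)) C` with `C ∈ L(U₁, V')`,
`β ∈ W^{2,∞}(a, b)`, `β > 0` on `[a, b)`. The value at `s = b` plays no role (there the
operator `B₁(b)` is `0`). -/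
def RegularB₁ (A : PosOp H) (B₁ : ℝ → U₁ →L[ℝ] StrongDual ℝ A.V) (a b : ℝ) : Prop :=
  (∃ F : ℝ → U₁ →L[ℝ] H, ContDiffOn ℝ 1 F (Icc a b) ∧ ∀ s ∈ Ico a b, B₁ s = A.pivot ∘L F s) ∨
  (∃ (β : ℝ → ℝ) (C : U₁ →L[ℝ] StrongDual ℝ A.V), IsW2Infty β a b ∧
    (∀ s ∈ Ico a b, 0 < β s) ∧ ∀ s ∈ Ico a b, B₁ s = √(β s) • C)

/-- Time regularity of the delayed damping operator on `[a, b)`: it extends to an element of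
`C([a, b]; L(U₂, H))`. -/
def RegularB₂ (B₂ : ℝ → U₂ →L[ℝ] H) (a b : ℝ) : Prop :=
  ∃ F : ℝ → U₂ →L[ℝ] H, ContinuousOn F (Icc a b) ∧ ∀ s ∈ Ico a b, B₂ s = F s

/-- `g = B₁* u_t` in `L²(a, b; U₁)`. As `u_t` is only `H`-valued while `B₁(s)*` is defined on `V`,
this is understood as the time derivative of the `U₁`-valued output:
`B₁(s)* (u(s + h) - u(s)) / h → g(s)` strongly in `L²` as `h → 0⁺`. If `B₁(s) = √(β(s)) C`,
it says that `C* u ∈ H¹(a, b; U₁)` and `g = √β (C* u)_t`; if `B₁` is bounded,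
`g` is just `B₁(s)* u_t(s)` almost everywhere. -/
def IsDampingTrace {A : PosOp H} (B₁ : ℝ → U₁ →L[ℝ] StrongDual ℝ A.V) (a b : ℝ)
    (u : ℝ → A.V) (g : ℝ → U₁) : Prop :=
  MemLp g 2 (volume.restrict (Ioc a b)) ∧
  Tendsto (fun h : ℝ => ∫⁻ s in Ioc a (b - h),
    ‖h⁻¹ • dualOp (B₁ s) (u (s + h) - u s) - g s‖ₑ ^ 2) (𝓝[>] 0) (𝓝 0)

/-- `w` is a weak solution on `[a, b]` of the undelayed damped equation
`w_tt + A w + B₁(s) B₁(s)* w_t = 0`, with `w_t = v`, `B₁* w_t = g`: the equation holds in `V'`,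
integrated in time. The initial data are `w a` and `v a`. -/
structure IsDampedSol (A : PosOp H) (B₁ : ℝ → U₁ →L[ℝ] StrongDual ℝ A.V) (a b : ℝ)
    (w : ℝ → A.V) (v : ℝ → H) (g : ℝ → U₁) : Prop where
  cont_w : ContinuousOn w (Icc a b)
  cont_v : ContinuousOn v (Icc a b)
  deriv : ∀ s ∈ Icc a b, HasDerivWithinAt (fun r => A.incl (w r)) (v s) (Icc a b) s
  trace : IsDampingTrace B₁ a b w g
  eqn : ∀ φ : A.V, ∀ s ∈ Icc a b, ⟪v s, A.incl φ⟫ - ⟪v a, A.incl φ⟫ +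
    ∫ r in a..s, (⟪w r, φ⟫ + ⟪g r, dualOp (B₁ r) φ⟫) = 0

/-- `u ∈ C([0, ∞); V) ∩ C¹([0, ∞); H)`, with `u_t = v`, is a weak solution on `[0, ∞)` of
`u_tt(s) + A u(s) + B₁(s) B₁(s)* u_t(s) + B₂(s) B₂(s)* u_t(s - τ) = 0`, where `t n` are the
switching times, the undelayed damping acting on the intervals `[t (2n), t (2n+1))`.
The initial data are `u 0` and `v 0`. -/
structure IsSol (A : PosOp H) (B₁ : ℝ → U₁ →L[ℝ] StrongDual ℝ A.V) (B₂ : ℝ → U₂ →L[ℝ] H)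
    (τ : ℝ) (t : ℕ → ℝ) (u : ℝ → A.V) (v : ℝ → H) : Prop where
  cont_u : ContinuousOn u (Ici 0)
  cont_v : ContinuousOn v (Ici 0)
  deriv : ∀ s ∈ Ici (0 : ℝ), HasDerivWithinAt (fun r => A.incl (u r)) (v s) (Ici 0) s
  eqn : ∃ g : ℝ → U₁, (∀ n, IsDampingTrace B₁ (t (2 * n)) (t (2 * n + 1)) u g) ∧
    ∀ φ : A.V, ∀ s ∈ Ici (0 : ℝ), ⟪v s, A.incl φ⟫ - ⟪v 0, A.incl φ⟫ +
      ∫ r in 0..s, (⟪u r, φ⟫ + ⟪g r, dualOp (B₁ r) φ⟫ +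
        ⟪(B₂ r).adjoint (v (r - τ)), (B₂ r).adjoint (A.incl φ)⟫) = 0

/-- The observability inequality for the undelayed damped equation on `[a, b]`, observed up to the
time `a + T` and with the constant `d`:
`E_S(a + T) ≤ d ∫_a^{a+T} ‖B₁* w_t‖²` for all weak solutions `w`. -/
def Observable (A : PosOp H) (B₁ : ℝ → U₁ →L[ℝ] StrongDual ℝ A.V) (a b T d : ℝ) : Prop :=
  ∀ (w : ℝ → A.V) (v : ℝ → H) (g : ℝ → U₁), IsDampedSol A B₁ a b w v g →
    A.energy (w (a + T)) (v (a + T)) ≤ d * ∫ s in a..(a + T), ‖g s‖ ^ 2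

end Damping

end DelayDamping

end

open DelayDamping

/-!
A weak solution has a velocity in `H` only, so the equation cannot be tested with it. It is
averaged over `[s, s + h]` instead and tested with the difference quotient of the solution, for
which the energy balance is an exact identity. As `h → 0` the dissipation term converges because
a damping family that is uniformly continuous relative to the graph norms
`φ ↦ ‖φ‖_H + ‖B₁* φ‖` can be shifted in time at a cost controlled by `u_t` and the damping trace.
Both forms of regular damping have this property on compact subintervals, and the identity
extends to the right endpoint by continuity.

On `[t (2n), t (2n+1)]` the energy is therefore nonincreasing, and observability turns the identity
into the contraction `E(t (2n+1)) ≤ d / (d + 1) * E(t (2n))`. On the delayed interval that follows,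
the delayed velocity is a velocity of this damped interval, so it is bounded by `E(t (2n))`, and
Gronwall's inequality for `E + E(t (2n))` gives
`E(t (2n+2)) ≤ (exp (K (t (2n+2) - t (2n+1))) (d / (d + 1) + 1) - 1) * E(t (2n))`.
A factor uniformly below `1` yields geometric, hence exponential, decay.
-/

namespace DelayDamping

/-! ### Convergence in mean -/

section Lp

variable {X ι E F G : Type*} [MeasurableSpace X] {μ : Measure X} [NormedAddCommGroup E]
  [NormedAddCommGroup F] [NormedAddCommGroup G]

theorem tendsto_eLpNorm_vadd_sub {M : Type*} [AddMonoid M] [TopologicalSpace M]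
    [MeasurableSpace M] [OpensMeasurableSpace M] [TopologicalSpace X] [R1Space X] [BorelSpace X]
    [AddAction M X] [ContinuousVAdd M X] [IsLocallyFiniteMeasure μ] [μ.InnerRegularCompactLTTop]
    [VAddInvariantMeasure M X μ] {p : ENNReal} [Fact (1 ≤ p)] [Fact (p ≠ ⊤)] {f : X → E}
    (hf : MemLp f p μ) :
    Tendsto (fun c : M => eLpNorm (fun x => f (c +ᵥ x) - f x) p μ) (𝓝 0) (𝓝 0) := by
  have hcont : Continuous fun c : M => DomAddAct.mk c +ᵥ hf.toLp f := by fun_prop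
  refine (tendsto_iff_edist_tendsto_0.1 (hcont.tendsto 0)).congr fun c => ?_
  simp only [DomAddAct.mk_vadd_toLp, Lp.edist_toLp_toLp, zero_vadd, Pi.sub_def]

theorem tendsto_eLpNorm_two_of_tendsto_lintegral {l : Filter ι} {f : ι → X → E}
    (h : Tendsto (fun i => ∫⁻ x, ‖f i x‖ₑ ^ 2 ∂μ) l (𝓝 0)) :
    Tendsto (fun i => eLpNorm (f i) 2 μ) l (𝓝 0) := by
  have hsqrt := (ENNReal.continuous_rpow_const (y := (1 / 2 : ℝ))).tendsto 0
  rw [ENNReal.zero_rpow_of_pos (by norm_num)] at hsqrt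
  refine (hsqrt.comp h).congr fun i => ?_
  simp [eLpNorm_eq_lintegral_rpow_enorm_toReal (f := f i) (μ := μ) two_ne_zero ENNReal.ofNat_ne_top]

section Bilin

variable [NormedSpace ℝ E] [NormedSpace ℝ F] [NormedSpace ℝ G] (B : E →L[ℝ] F →L[ℝ] G)
  {p q r : ENNReal} [ENNReal.HolderTriple p q r]

theorem eLpNorm_bilin_sub_le (hr : 1 ≤ r) {f f' : X → E} {g g' : X → F}
    (hf : AEStronglyMeasurable f μ) (hf' : AEStronglyMeasurable f' μ)
    (hg : AEStronglyMeasurable g μ) (hg' : AEStronglyMeasurable g' μ) :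
    eLpNorm (fun x => B (f' x) (g' x) - B (f x) (g x)) r μ ≤
      ‖B‖₊ * eLpNorm (fun x => f' x - f x) p μ * eLpNorm (fun x => g' x - g x) q μ +
        ‖B‖₊ * eLpNorm (fun x => f' x - f x) p μ * eLpNorm g q μ +
        ‖B‖₊ * eLpNorm f p μ * eLpNorm (fun x => g' x - g x) q μ := by
  have hB : ∀ {u : X → E} {v : X → F}, AEStronglyMeasurable u μ → AEStronglyMeasurable v μ →
      eLpNorm (fun x => B (u x) (v x)) r μ ≤ ‖B‖₊ * eLpNorm u p μ * eLpNorm v q μ := fun hu hv =>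
    eLpNorm_le_eLpNorm_mul_eLpNorm_of_nnnorm hu hv (fun x y => B x y) ‖B‖₊
      (Eventually.of_forall fun x => B.le_opNorm₂ _ _)
  have hBm : ∀ {u : X → E} {v : X → F}, AEStronglyMeasurable u μ → AEStronglyMeasurable v μ →
      AEStronglyMeasurable (fun x => B (u x) (v x)) μ := fun hu hv =>
    B.aestronglyMeasurable_comp₂ hu hv
  have hdf : AEStronglyMeasurable (fun x => f' x - f x) μ := hf'.sub hf
  have hdg : AEStronglyMeasurable (fun x => g' x - g x) μ := hg'.sub hg
  have hexpand : (fun x => B (f' x) (g' x) - B (f x) (g x)) =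
      (fun x => B (f' x - f x) (g' x - g x)) + (fun x => B (f' x - f x) (g x)) +
        fun x => B (f x) (g' x - g x) := by
    ext x
    simp only [map_sub, _root_.sub_apply, Pi.add_apply]
    abel
  rw [hexpand]
  refine (eLpNorm_add_le ((hBm hdf hdg).add (hBm hdf hg)) (hBm hf hdg) hr).trans ?_
  gcongr
  · refine (eLpNorm_add_le (hBm hdf hdg) (hBm hdf hg) hr).trans ?_
    gcongr
    exacts [hB hdf hdg, hB hdf hg]
  · exact hB hf hdg

theorem tendsto_eLpNorm_bilin_sub (hr : 1 ≤ r) {l : Filter ι} {f : X → E} {f' : ι → X → E}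
    {g : X → F} {g' : ι → X → F} (hf : MemLp f p μ) (hg : MemLp g q μ)
    (hf' : ∀ᶠ i in l, AEStronglyMeasurable (f' i) μ)
    (hg' : ∀ᶠ i in l, AEStronglyMeasurable (g' i) μ)
    (hff' : Tendsto (fun i => eLpNorm (fun x => f' i x - f x) p μ) l (𝓝 0))
    (hgg' : Tendsto (fun i => eLpNorm (fun x => g' i x - g x) q μ) l (𝓝 0)) :
    Tendsto (fun i => eLpNorm (fun x => B (f' i x) (g' i x) - B (f x) (g x)) r μ) l (𝓝 0) := by
  have h₁ : Tendsto (fun i => ‖B‖₊ * eLpNorm (fun x => f' i x - f x) p μ) l (𝓝 0) := by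
    simpa using ENNReal.Tendsto.const_mul hff' (Or.inr ENNReal.coe_ne_top)
  have h₂ := ENNReal.Tendsto.mul h₁ (by simp) hgg' (by simp)
  have h₃ := ENNReal.Tendsto.mul_const h₁ (Or.inr hg.2.ne)
  have h₄ := ENNReal.Tendsto.const_mul hgg' (a := ‖B‖₊ * eLpNorm f p μ)
    (Or.inr (ENNReal.mul_ne_top ENNReal.coe_ne_top hf.2.ne))
  refine tendsto_of_tendsto_of_tendsto_of_le_of_le' tendsto_const_nhds
    (by simpa using (h₂.add h₃).add h₄) (Eventually.of_forall fun _ => zero_le) ?_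
  filter_upwards [hf', hg'] with i hfi hgi
  exact eLpNorm_bilin_sub_le B hr hf.1 hfi hg.1 hgi

end Bilin

theorem enorm_integral_integral_sub_integral_le {Y : Type*} [MeasurableSpace Y] {ν : Measure Y}
    [SFinite μ] [IsProbabilityMeasure ν] [NormedSpace ℝ E] {K : X → Y → E} {f : X → E}
    {κ : ENNReal} (hK : AEStronglyMeasurable (Function.uncurry K) (μ.prod ν))
    (hf : Integrable f μ) (hκ : ∀ᵐ y ∂ν, eLpNorm (fun x => K x y - f x) 1 μ ≤ κ) :
    ‖(∫ x, ∫ y, K x y ∂ν ∂μ) - ∫ x, f x ∂μ‖ₑ ≤ κ := by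
  rcases eq_or_ne κ ⊤ with rfl | hκ'
  · exact le_top
  have hf' : Integrable (fun p : X × Y => f p.1) (μ.prod ν) := hf.comp_fst ν
  have hsub : AEStronglyMeasurable (fun p : X × Y => K p.1 p.2 - f p.1) (μ.prod ν) := hK.sub hf'.1
  have hle : ∫⁻ p, ‖K p.1 p.2 - f p.1‖ₑ ∂μ.prod ν ≤ κ := by
    rw [lintegral_prod_symm _ hsub.enorm]
    calc ∫⁻ y, ∫⁻ x, ‖K x y - f x‖ₑ ∂μ ∂ν ≤ ∫⁻ _, κ ∂ν := lintegral_mono_ae <| by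
          simpa only [eLpNorm_one_eq_lintegral_enorm] using hκ
      _ = κ := by simp
  have hint : Integrable (fun p : X × Y => K p.1 p.2) (μ.prod ν) :=
    (Integrable.add ⟨hsub, hle.trans_lt hκ'.lt_top⟩ hf').congr
      (Eventually.of_forall fun p => sub_add_cancel _ _)
  have hfst : ∫ x, f x ∂μ = ∫ p, f p.1 ∂μ.prod ν := by simp [integral_fun_fst]
  rw [integral_integral hint, hfst, ← integral_sub hint hf']
  exact (enorm_integral_le_lintegral_enorm _).trans hle

theorem memLp_restrict_of_continuousOn [TopologicalSpace X] [OpensMeasurableSpace X]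
    [SecondCountableTopologyEither X E] [IsFiniteMeasureOnCompacts μ] {p : ENNReal} {f : X → E}
    {s t : Set X} (hs : IsCompact s) (hf : ContinuousOn f s) (ht : MeasurableSet t)
    (hts : t ⊆ s) : MemLp f p (μ.restrict t) := by
  have : IsFiniteMeasure (μ.restrict t) :=
    ⟨by simpa using (measure_mono hts).trans_lt hs.measure_lt_top⟩
  obtain ⟨M, hM⟩ := hs.exists_bound_of_continuousOn hf
  exact MemLp.of_bound ((hf.mono hts).aestronglyMeasurable ht) M
    ((ae_restrict_mem ht).mono fun x hx => hM x (hts hx))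

theorem tendsto_eLpNorm_sub_of_tendstoUniformlyOn [IsFiniteMeasure μ] {s : Set X}
    (hs : ∀ᵐ x ∂μ, x ∈ s) {p : ENNReal} {l : Filter ι} {f : ι → X → E} {g : X → E}
    (h : TendstoUniformlyOn f g l s) :
    Tendsto (fun i => eLpNorm (fun x => f i x - g x) p μ) l (𝓝 0) := by
  have hμ : μ univ ^ p.toReal⁻¹ ≠ ⊤ :=
    ENNReal.rpow_ne_top_of_nonneg (by positivity) (measure_ne_top μ univ)
  refine ENNReal.tendsto_nhds_zero.2 fun ε hε => ?_
  obtain ⟨δ, hδ, hlt⟩ := ENNReal.exists_nnreal_pos_mul_lt hμ hε.ne'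
  filter_upwards [Metric.tendstoUniformlyOn_iff.1 h δ hδ] with i hi
  refine (eLpNorm_le_of_ae_bound (C := δ) (hs.mono fun x hx => ?_)).trans ?_
  · rw [← dist_eq_norm, dist_comm]
    exact (hi x hx).le
  · rw [ENNReal.ofReal_coe_nnreal, mul_comm]
    exact hlt.le

theorem integrable_inner [InnerProductSpace ℝ E] {f g : X → E} (hf : MemLp f 2 μ)
    (hg : MemLp g 2 μ) : Integrable (fun x => ⟪f x, g x⟫) μ :=
  memLp_one_iff_integrable.1 <| hf.of_bilin (fun x y => ⟪x, y⟫) 1 hg (hf.1.inner hg.1) <|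
    Eventually.of_forall fun x => by simpa only [one_mul] using nnnorm_inner_le_nnnorm (𝕜 := ℝ) _ _

end Lp

/-! ### Difference quotients and graph-norm continuity -/

section DiffQuot

variable {E : Type*} [NormedAddCommGroup E] [NormedSpace ℝ E] {f f' : ℝ → E} {a b c h s : ℝ}

/-- The forward difference quotient of `f` at `s` with increment `h`, the test function that
replaces the derivative in the energy identity. Its value at `h = 0` is `0`. -/
noncomputable def diffQuot (h : ℝ) (f : ℝ → E) (s : ℝ) : E := h⁻¹ • (f (s + h) - f s)

theorem map_diffQuot {F : Type*} [NormedAddCommGroup F] [NormedSpace ℝ F] (L : E →L[ℝ] F)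
    (h : ℝ) (f : ℝ → E) (s : ℝ) : L (diffQuot h f s) = diffQuot h (fun r => L (f r)) s := by
  simp only [diffQuot, map_smul, map_sub]

theorem mapsTo_add_Icc (hh : 0 ≤ h) (hc : c + h ≤ b) :
    MapsTo (fun r => r + h) (Icc a c) (Icc a b) := fun _ hr =>
  ⟨by linarith [hr.1], by linarith [hr.2]⟩

theorem continuousOn_diffQuot (hf : ContinuousOn f (Icc a b)) (hh : 0 ≤ h) (hc : c + h ≤ b) :
    ContinuousOn (diffQuot h f) (Icc a c) :=
  ((hf.comp (by fun_prop) (mapsTo_add_Icc hh hc)).sub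
    (hf.mono (Icc_subset_Icc_right (by linarith)))).const_smul _

theorem hasDerivWithinAt_diffQuot (hf : ∀ s ∈ Icc a b, HasDerivWithinAt f (f' s) (Icc a b) s)
    (hh : 0 ≤ h) (hc : c + h ≤ b) (hs : s ∈ Icc a c) :
    HasDerivWithinAt (diffQuot h f) (diffQuot h f' s) (Icc a c) s := by
  have hmaps := mapsTo_add_Icc (a := a) hh hc
  have hshift : HasDerivWithinAt (fun r => f (r + h)) (f' (s + h)) (Icc a c) s := by
    have := (hf (s + h) (hmaps hs)).scomp s ((hasDerivWithinAt_id s (Icc a c)).add_const h) hmaps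
    rwa [one_smul] at this
  have hbase : HasDerivWithinAt f (f' s) (Icc a c) s :=
    (hf s ⟨hs.1, by linarith [hs.2]⟩).mono (Icc_subset_Icc_right (by linarith))
  exact (hshift.sub hbase).const_smul h⁻¹

theorem tendstoUniformlyOn_diffQuot (hf : ∀ s ∈ Icc a b, HasDerivWithinAt f (f' s) (Icc a b) s)
    (hf' : ContinuousOn f' (Icc a b)) (hcb : c < b) :
    TendstoUniformlyOn (fun h => diffQuot h f) f' (𝓝[>] 0) (Icc a c) := by
  refine Metric.tendstoUniformlyOn_iff.2 fun ε hε => ?_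
  obtain ⟨δ, hδ, hmod⟩ := Metric.uniformContinuousOn_iff_le.1
    (isCompact_Icc.uniformContinuousOn_of_continuous hf') (ε / 2) (half_pos hε)
  filter_upwards [Ioo_mem_nhdsGT (lt_min hδ (sub_pos.2 hcb))] with h ⟨hh, hhlt⟩ s hs
  have hhδ : h < δ := hhlt.trans_le (min_le_left _ _)
  have hsub : Icc s (s + h) ⊆ Icc a b :=
    Icc_subset_Icc hs.1 (by linarith [hs.2, hhlt.trans_le (min_le_right _ _)])
  have hmean : ‖f (s + h) - f s - h • f' s‖ ≤ ε / 2 * h := by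
    have := (convex_Icc s (s + h)).norm_image_sub_le_of_norm_hasDerivWithin_le
      (f := fun r => f r - (r - s) • f' s) (f' := fun r => f' r - f' s) (C := ε / 2)
      (fun r hr => ((hf r (hsub hr)).mono hsub).sub
        (by simpa using ((hasDerivWithinAt_id r _).sub_const s).smul_const (f' s)))
      (fun r hr => by
        rw [← dist_eq_norm]
        refine hmod r (hsub hr) s (hsub (left_mem_Icc.2 (by linarith))) ?_
        rw [Real.dist_eq, abs_of_nonneg (by linarith [hr.1])]
        linarith [hr.2])
      (left_mem_Icc.2 (by linarith)) (right_mem_Icc.2 (by linarith))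
    simpa [sub_right_comm, abs_of_pos hh] using this
  have hquot : diffQuot h f s - f' s = h⁻¹ • (f (s + h) - f s - h • f' s) := by
    rw [diffQuot, smul_sub _ _ (h • f' s), inv_smul_smul₀ hh.ne']
  rw [dist_comm, dist_eq_norm, hquot, norm_smul, norm_inv, Real.norm_of_nonneg hh.le,
    inv_mul_lt_iff₀ hh]
  nlinarith

end DiffQuot

section Graph

variable {T U V H : Type*} [PseudoMetricSpace T] [NormedAddCommGroup U] [NormedSpace ℝ U]
  [NormedAddCommGroup V] [NormedSpace ℝ V] [NormedAddCommGroup H] [NormedSpace ℝ H]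
  {N : T → V →L[ℝ] U} {ι : V →L[ℝ] H} {s : Set T}

/-- Uniform continuity on `s` of the operators `N x : V → U`, relative to their graph norms
`φ ↦ ‖ι φ‖ + ‖N x φ‖` instead of the norm of `V`: this is what the difference quotients of a
trajectory allow, being controlled through `ι` and `N` only. -/
def GraphUniformContinuousOn (N : T → V →L[ℝ] U) (ι : V →L[ℝ] H) (s : Set T) : Prop :=
  ∀ ε > 0, ∃ δ > 0, ∀ x ∈ s, ∀ y ∈ s, dist y x ≤ δ →
    ∀ φ, ‖N y φ - N x φ‖ ≤ ε * (‖ι φ‖ + ‖N x φ‖)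

namespace GraphUniformContinuousOn

theorem congr {N' : T → V →L[ℝ] U} (h : GraphUniformContinuousOn N ι s) (hN : EqOn N' N s) :
    GraphUniformContinuousOn N' ι s := fun ε hε =>
  (h ε hε).imp fun δ ⟨hδ, h⟩ => ⟨hδ, fun x hx y hy => by rw [hN hx, hN hy]; exact h x hx y hy⟩

theorem continuousOn (h : GraphUniformContinuousOn N ι s) : ContinuousOn N s := by
  refine fun x hx => Metric.continuousWithinAt_iff.2 fun ε hε => ?_
  set R := ‖ι‖ + ‖N x‖ + 1
  have hR : 0 < R := by positivity
  obtain ⟨δ, hδ, h⟩ := h (ε / 2 / R) (by positivity)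
  refine ⟨δ, hδ, fun y hy hxy => ?_⟩
  rw [dist_eq_norm]
  refine (ContinuousLinearMap.opNorm_le_bound _ (half_pos hε).le fun φ => ?_).trans_lt
    (half_lt_self hε)
  calc ‖N y φ - N x φ‖ ≤ ε / 2 / R * (‖ι φ‖ + ‖N x φ‖) := h x hx y hy hxy.le φ
    _ ≤ ε / 2 / R * (‖ι‖ * ‖φ‖ + ‖N x‖ * ‖φ‖) := by
        gcongr <;> exact ContinuousLinearMap.le_opNorm _ _
    _ ≤ ε / 2 / R * (R * ‖φ‖) := by
        gcongr
        nlinarith [norm_nonneg φ]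
    _ = ε / 2 * ‖φ‖ := by field_simp

end GraphUniformContinuousOn

theorem graphUniformContinuousOn_of_comp {F : T → H →L[ℝ] U} (hs : IsCompact s)
    (hF : ContinuousOn F s) (ι : V →L[ℝ] H) :
    GraphUniformContinuousOn (fun x => F x ∘L ι) ι s := by
  intro ε hε
  obtain ⟨δ, hδ, h⟩ := Metric.uniformContinuousOn_iff_le.1
    (hs.uniformContinuousOn_of_continuous hF) ε hε
  refine ⟨δ, hδ, fun x hx y hy hxy φ => ?_⟩
  calc ‖F y (ι φ) - F x (ι φ)‖ ≤ ‖F y - F x‖ * ‖ι φ‖ := (F y - F x).le_opNorm _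
    _ ≤ ε * ‖ι φ‖ := by
        gcongr
        rw [← dist_eq_norm]
        exact h y hy x hx hxy
    _ ≤ ε * (‖ι φ‖ + ‖F x (ι φ)‖) := by
        gcongr
        exact le_add_of_nonneg_right (norm_nonneg _)

theorem graphUniformContinuousOn_smul {α : T → ℝ} (hs : IsCompact s) (hα : ContinuousOn α s)
    (hpos : ∀ x ∈ s, 0 < α x) (L : V →L[ℝ] U) (ι : V →L[ℝ] H) :
    GraphUniformContinuousOn (fun x => α x • L) ι s := by
  intro ε hε
  rcases s.eq_empty_or_nonempty with rfl | hne
  · exact ⟨1, one_pos, by simp⟩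
  obtain ⟨x₀, hx₀, hmin⟩ := hs.exists_isMinOn hne hα
  obtain ⟨δ, hδ, h⟩ := Metric.uniformContinuousOn_iff_le.1
    (hs.uniformContinuousOn_of_continuous hα) (ε * α x₀) (mul_pos hε (hpos _ hx₀))
  refine ⟨δ, hδ, fun x hx y hy hxy φ => ?_⟩
  calc ‖α y • L φ - α x • L φ‖ = dist (α y) (α x) * ‖L φ‖ := by
        rw [← sub_smul, norm_smul, dist_eq_norm]
    _ ≤ ε * α x * ‖L φ‖ := by
        gcongr
        exact (h y hy x hx hxy).trans (by gcongr; exact hmin hx)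
    _ = ε * ‖α x • L φ‖ := by
        rw [norm_smul, Real.norm_of_nonneg (hpos x hx).le, mul_assoc]
    _ ≤ ε * (‖ι φ‖ + ‖α x • L φ‖) := by
        gcongr
        exact le_add_of_nonneg_left (norm_nonneg _)

end Graph

section Average

theorem tendsto_eLpNorm_sub_of_norm_sub_le {X ι E : Type*} [MeasurableSpace X] {μ : Measure X}
    [IsFiniteMeasure μ] [NormedAddCommGroup E] {p : ENNReal} (hp : 1 ≤ p) {l : Filter ι}
    {f g : ι → X → E} {z : X → E} {M : ℝ} (hf : ∀ᶠ i in l, AEStronglyMeasurable (f i) μ)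
    (hg : ∀ᶠ i in l, AEStronglyMeasurable (g i) μ) (hz : MemLp z p μ)
    (hfg : ∀ ε > 0, ∀ᶠ i in l, ∀ᵐ x ∂μ, ‖f i x - g i x‖ ≤ ε * (M + ‖g i x‖))
    (hgz : Tendsto (fun i => eLpNorm (fun x => g i x - z x) p μ) l (𝓝 0)) :
    Tendsto (fun i => eLpNorm (fun x => f i x - z x) p μ) l (𝓝 0) := by
  suffices hdiff : Tendsto (fun i => eLpNorm (fun x => f i x - g i x) p μ) l (𝓝 0) by
    refine tendsto_of_tendsto_of_tendsto_of_le_of_le' tendsto_const_nhds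
      (by simpa using hdiff.add hgz) (Eventually.of_forall fun _ => zero_le) ?_
    filter_upwards [hf, hg] with i hfi hgi
    calc eLpNorm (fun x => f i x - z x) p μ = eLpNorm ((f i - g i) + (g i - z)) p μ := by
          rw [sub_add_sub_cancel]; rfl
      _ ≤ _ := eLpNorm_add_le (hfi.sub hgi) (hgi.sub hz.1) hp
  set R := eLpNorm (fun _ : X => M) p μ + (1 + eLpNorm z p μ)
  have hR : R ≠ ⊤ := by
    have := (memLp_const M : MemLp (fun _ : X => M) p μ).2.ne
    have := hz.2.ne
    finiteness
  refine ENNReal.tendsto_nhds_zero.2 fun η hη => ?_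
  obtain ⟨ε, hε, hlt⟩ := ENNReal.exists_nnreal_pos_mul_lt hR hη.ne'
  filter_upwards [hg, hfg ε (by exact_mod_cast hε), ENNReal.tendsto_nhds_zero.1 hgz 1 one_pos]
    with i hgi hle hgz₁
  have hbound : eLpNorm (fun x => M + ‖g i x‖) p μ ≤ R := by
    refine (eLpNorm_add_le aestronglyMeasurable_const hgi.norm hp).trans ?_
    rw [eLpNorm_norm]
    refine add_le_add_right ?_ _
    calc eLpNorm (g i) p μ = eLpNorm ((g i - z) + z) p μ := by rw [sub_add_cancel]
      _ ≤ eLpNorm (g i - z) p μ + eLpNorm z p μ := eLpNorm_add_le (hgi.sub hz.1) hz.1 hp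
      _ ≤ 1 + eLpNorm z p μ := by
          gcongr
          exact hgz₁
  calc eLpNorm (fun x => f i x - g i x) p μ ≤ ε • eLpNorm (fun x => M + ‖g i x‖) p μ :=
        eLpNorm_le_nnreal_smul_eLpNorm_of_ae_le_mul (hle.mono fun x hx =>
          hx.trans (mul_le_mul_of_nonneg_left (Real.le_norm_self _) ε.2)) p
    _ ≤ ε * R := by
        rw [ENNReal.smul_def, smul_eq_mul]
        gcongr
    _ ≤ η := hlt.le

theorem tendsto_integral_average {X E : Type*} [MeasurableSpace X] {μ : Measure X} [SFinite μ]
    [NormedAddCommGroup E] [NormedSpace ℝ E] {K : ℝ → X → ℝ → E} {f : X → E}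
    (hK : ∀ᶠ h in 𝓝[>] (0 : ℝ), AEStronglyMeasurable (Function.uncurry (K h))
      (μ.prod (volume.restrict (Ioc (0 : ℝ) h)))) (hf : Integrable f μ)
    (hlim : Tendsto (fun p : ℝ × ℝ => eLpNorm (fun x => K p.1 x p.2 - f x) 1 μ)
      (𝓝[>] 0 ×ˢ 𝓝[>] 0) (𝓝 0)) :
    Tendsto (fun h : ℝ => ∫ x, (⨍ ρ in Ioc 0 h, K h x ρ) ∂μ) (𝓝[>] 0) (𝓝 (∫ x, f x ∂μ)) := by
  refine tendsto_iff_edist_tendsto_0.2 (ENNReal.tendsto_nhds_zero.2 fun η hη => ?_)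
  obtain ⟨s, hs, hsη⟩ := eventually_prod_self_iff'.1 (ENNReal.tendsto_nhds_zero.1 hlim η hη)
  obtain ⟨δ, hδ, hδs⟩ := mem_nhdsGT_iff_exists_Ioo_subset.1 hs
  filter_upwards [hK, Ioo_mem_nhdsGT hδ] with h hKh hh
  have hne : NeZero (volume.restrict (Ioc (0 : ℝ) h)) :=
    ⟨by simpa [Measure.restrict_eq_zero] using hh.1⟩
  have hac : ((volume.restrict (Ioc (0 : ℝ) h)) univ)⁻¹ • volume.restrict (Ioc (0 : ℝ) h) ≪
      volume.restrict (Ioc (0 : ℝ) h) := Measure.smul_absolutelyContinuous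
  have hκ : ∀ ρ ∈ Ioc 0 h, eLpNorm (fun x => K h x ρ - f x) 1 μ ≤ η := fun ρ hρ =>
    hsη h (hδs hh) ρ (hδs ⟨hρ.1, hρ.2.trans_lt hh.2⟩)
  simp only [average_eq', edist_eq_enorm_sub]
  exact enorm_integral_integral_sub_integral_le
    (hKh.mono_ac (Measure.AbsolutelyContinuous.rfl.prod hac)) hf
    (hac.ae_le ((ae_restrict_mem measurableSet_Ioc).mono hκ))

variable {E : Type*} [NormedAddCommGroup E] {g : ℝ → E} {a b c : ℝ}

theorem tendsto_eLpNorm_add_sub {p : ENNReal} [Fact (1 ≤ p)] [Fact (p ≠ ⊤)] (hcb : c < b)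
    (hg : MemLp g p (volume.restrict (Ioc a b))) :
    Tendsto (fun ρ => eLpNorm (fun s => g (s + ρ) - g s) p (volume.restrict (Ioc a c)))
      (𝓝[>] 0) (𝓝 0) := by
  have hg' := (memLp_indicator_iff_restrict measurableSet_Ioc).2 hg
  refine tendsto_of_tendsto_of_tendsto_of_le_of_le' tendsto_const_nhds
    ((tendsto_eLpNorm_vadd_sub hg').mono_left nhdsWithin_le_nhds)
    (Eventually.of_forall fun _ => zero_le) ?_
  filter_upwards [Ioo_mem_nhdsGT (sub_pos.2 hcb)] with ρ ⟨hρ, hρcb⟩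
  refine le_of_eq_of_le (eLpNorm_congr_ae ?_) (eLpNorm_mono_measure _ Measure.restrict_le_self)
  filter_upwards [ae_restrict_mem measurableSet_Ioc] with s hs
  have hs₀ : s ∈ Ioc a b := ⟨hs.1, by linarith [hs.2]⟩
  have hsρ : s + ρ ∈ Ioc a b := ⟨by linarith [hs.1], by linarith [hs.2]⟩
  simp only [vadd_eq_add, add_comm ρ, indicator_of_mem hs₀, indicator_of_mem hsρ]

theorem aestronglyMeasurable_comp_add_const
    (hg : AEStronglyMeasurable g (volume.restrict (Ioc a b))) {ρ : ℝ} (hρ : 0 ≤ ρ)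
    (hρb : c + ρ ≤ b) :
    AEStronglyMeasurable (fun s => g (s + ρ)) (volume.restrict (Ioc a c)) :=
  hg.comp_quasiMeasurePreserving <|
    (measurePreserving_add_right volume ρ).quasiMeasurePreserving.restrict fun s hs =>
      ⟨by linarith [hs.1], by linarith [hs.2]⟩

theorem aestronglyMeasurable_comp_add
    (hg : AEStronglyMeasurable g (volume.restrict (Ioc a b))) {h : ℝ} (hhb : c + h ≤ b) :
    AEStronglyMeasurable (fun p : ℝ × ℝ => g (p.1 + p.2))
      ((volume.restrict (Ioc a c)).prod (volume.restrict (Ioc 0 h))) := by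
  rw [Measure.prod_restrict]
  exact hg.comp_quasiMeasurePreserving <|
    (quasiMeasurePreserving_add volume volume).restrict fun p hp =>
      ⟨by linarith [hp.1.1, hp.2.1], by linarith [hp.1.2, hp.2.2]⟩

end Average

section Dissipation

variable {V H U : Type*} [NormedAddCommGroup V] [NormedSpace ℝ V] [NormedAddCommGroup H]
  [NormedSpace ℝ H] [NormedAddCommGroup U] [InnerProductSpace ℝ U] {N : ℝ → V →L[ℝ] U}
  {ι : V →L[ℝ] H} {D : ℝ → ℝ → V} {g z : ℝ → U} {a b c M : ℝ}

theorem aestronglyMeasurable_clm_add {D : ℝ → V} (hN : ContinuousOn N (Icc a b))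
    (hD : ContinuousOn D (Icc a c)) {ρ : ℝ} (hρ : 0 ≤ ρ) (hρb : c + ρ ≤ b) :
    AEStronglyMeasurable (fun s => N (s + ρ) (D s)) (volume.restrict (Ioc a c)) := by
  refine ContinuousOn.aestronglyMeasurable ?_ measurableSet_Ioc
  exact ((hN.comp (by fun_prop) (mapsTo_add_Icc hρ hρb)).clm_apply hD).mono Ioc_subset_Icc_self

theorem GraphUniformContinuousOn.tendsto_eLpNorm_shift {p : ENNReal} (hp : 1 ≤ p) (hcb : c < b)
    (hN : GraphUniformContinuousOn N ι (Icc a b))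
    (hD : ∀ᶠ h in 𝓝[>] (0 : ℝ), ContinuousOn (D h) (Icc a c))
    (hM : ∀ᶠ h in 𝓝[>] (0 : ℝ), ∀ s ∈ Icc a c, ‖ι (D h s)‖ ≤ M)
    (hz : MemLp z p (volume.restrict (Ioc a c)))
    (hlim : Tendsto (fun h => eLpNorm (fun s => N s (D h s) - z s) p (volume.restrict (Ioc a c)))
      (𝓝[>] 0) (𝓝 0)) :
    Tendsto (fun q : ℝ × ℝ => eLpNorm (fun s => N (s + q.2) (D q.1 s) - z s) p
      (volume.restrict (Ioc a c))) (𝓝[>] 0 ×ˢ 𝓝[>] 0) (𝓝 0) := by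
  have hsmall : ∀ᶠ ρ : ℝ in 𝓝[>] 0, ρ ∈ Ioo 0 (b - c) := Ioo_mem_nhdsGT (sub_pos.2 hcb)
  refine tendsto_eLpNorm_sub_of_norm_sub_le (ι := ℝ × ℝ) (f := fun q s => N (s + q.2) (D q.1 s))
    (g := fun q s => N s (D q.1 s)) (M := M) hp ?_ ?_ hz (fun ε hε => ?_) (hlim.comp tendsto_fst)
  · filter_upwards [hD.prod_mk hsmall] with q ⟨hq, hρ⟩
    exact aestronglyMeasurable_clm_add hN.continuousOn hq hρ.1.le (by linarith [hρ.2])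
  · filter_upwards [hD.prod_inl _] with q hq
    simpa only [add_zero] using
      aestronglyMeasurable_clm_add hN.continuousOn hq le_rfl (by linarith)
  · obtain ⟨δ, hδ, hNδ⟩ := hN ε hε
    filter_upwards [hM.prod_mk (hsmall.and (Ioo_mem_nhdsGT hδ))] with q ⟨hMq, hρ, hρδ⟩
    filter_upwards [ae_restrict_mem measurableSet_Ioc] with s hs
    refine (hNδ s ⟨hs.1.le, by linarith [hs.2]⟩ (s + q.2)
      ⟨by linarith [hs.1, hρ.1], by linarith [hs.2, hρ.2]⟩ ?_ _).trans ?_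
    · rw [Real.dist_eq, add_sub_cancel_left, abs_of_pos hρ.1]
      exact hρδ.2.le
    · gcongr
      exact hMq s (Ioc_subset_Icc_self hs)

theorem GraphUniformContinuousOn.tendsto_integral_average (hcb : c < b)
    (hN : GraphUniformContinuousOn N ι (Icc a b))
    (hD : ∀ᶠ h in 𝓝[>] (0 : ℝ), ContinuousOn (D h) (Icc a c))
    (hM : ∀ᶠ h in 𝓝[>] (0 : ℝ), ∀ s ∈ Icc a c, ‖ι (D h s)‖ ≤ M)
    (hg : MemLp g 2 (volume.restrict (Ioc a b))) (hz : MemLp z 2 (volume.restrict (Ioc a c)))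
    (hlim : Tendsto (fun h => eLpNorm (fun s => N s (D h s) - z s) 2 (volume.restrict (Ioc a c)))
      (𝓝[>] 0) (𝓝 0)) :
    Tendsto (fun h : ℝ => ∫ s in Ioc a c, ⨍ ρ in Ioc 0 h, ⟪g (s + ρ), N (s + ρ) (D h s)⟫)
      (𝓝[>] 0) (𝓝 (∫ s in Ioc a c, ⟪g s, z s⟫)) := by
  have hsmall : ∀ᶠ ρ : ℝ in 𝓝[>] 0, ρ ∈ Ioo 0 (b - c) := Ioo_mem_nhdsGT (sub_pos.2 hcb)
  have hgc : MemLp g 2 (volume.restrict (Ioc a c)) :=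
    hg.mono_measure (Measure.restrict_mono (Ioc_subset_Ioc_right hcb.le) le_rfl)
  have : Fact ((2 : ENNReal) ≠ ⊤) := ⟨ENNReal.ofNat_ne_top⟩
  refine DelayDamping.tendsto_integral_average ?_ (integrable_inner hgc hz) ?_
  · filter_upwards [hD, hsmall] with h hDh hh
    refine (aestronglyMeasurable_comp_add hg.1 (by linarith [hh.2])).inner ?_
    rw [Measure.prod_restrict]
    refine ContinuousOn.aestronglyMeasurable ?_ (measurableSet_Ioc.prod measurableSet_Ioc)
    refine (hN.continuousOn.comp (by fun_prop) fun q hq => ?_).clm_apply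
      (hDh.comp (by fun_prop) fun q hq => Ioc_subset_Icc_self hq.1)
    exact ⟨by linarith [hq.1.1, hq.2.1], by linarith [hq.1.2, hq.2.2, hh.2]⟩
  · refine tendsto_eLpNorm_bilin_sub (innerSL ℝ) le_rfl hgc hz ?_ ?_
      ((tendsto_eLpNorm_add_sub hcb hg).comp tendsto_snd)
      (hN.tendsto_eLpNorm_shift one_le_two hcb hD hM hz hlim)
    · filter_upwards [hsmall.prod_inr _] with q hρ
      exact aestronglyMeasurable_comp_add_const hg.1 hρ.1.le (by linarith [hρ.2])
    · filter_upwards [hD.prod_mk hsmall] with q ⟨hq, hρ⟩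
      exact aestronglyMeasurable_clm_add hN.continuousOn hq hρ.1.le (by linarith [hρ.2])

end Dissipation

/-! ### The energy identity -/

theorem hasDerivWithinAt_integral_of_continuousOn {E : Type*} [NormedAddCommGroup E]
    [NormedSpace ℝ E] [CompleteSpace E] {f : ℝ → E} {a b s : ℝ} (hf : ContinuousOn f (Icc a b))
    (hs : s ∈ Icc a b) : HasDerivWithinAt (fun r => ∫ x in a..r, f x) (f s) (Icc a b) s :=
  have : Fact (s ∈ Icc a b) := ⟨hs⟩
  intervalIntegral.integral_hasDerivWithinAt_right
    ((hf.mono (Icc_subset_Icc_right hs.2)).intervalIntegrable_of_Icc hs.1)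
    (hf.stronglyMeasurableAtFilter_nhdsWithin measurableSet_Icc s) (hf s hs)

section WeakSolution

variable {H : Type*} [NormedAddCommGroup H] [InnerProductSpace ℝ H] [CompleteSpace H]
  {A : PosOp H} {a b c h s : ℝ} {w : ℝ → A.V} {v : ℝ → H}

instance PosOp.completeSpace_V (A : PosOp H) : CompleteSpace A.V := by
  refine Metric.complete_of_cauchySeq_tendsto fun u hu => ?_
  let S : A.V →ₗᵢ[ℝ] H := ⟨A.sqrtV, fun x => (A.norm_V x).symm⟩
  obtain ⟨p, hp⟩ := cauchySeq_tendsto_of_complete (A.incl.uniformContinuous.comp_cauchySeq hu)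
  obtain ⟨q, hq⟩ := cauchySeq_tendsto_of_complete (S.isometry.uniformContinuous.comp_cauchySeq hu)
  have hclosed : IsClosed (A.sqrt.graph : Set (H × H)) := A.sqrt_spec.1.isClosed
  have hmem : (p, q) ∈ A.sqrt.graph :=
    hclosed.mem_of_tendsto (hp.prodMk_nhds hq)
      (Eventually.of_forall fun n => A.sqrt.mem_graph (u n))
  obtain ⟨x, -, hx : S x = q⟩ := (LinearPMap.mem_graph_iff _).1 hmem
  exact ⟨x, S.isometry.isEmbedding.isInducing.tendsto_nhds_iff.2 (hx ▸ hq)⟩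

theorem PosOp.energy_nonneg (A : PosOp H) (u : A.V) (v : H) : 0 ≤ A.energy u v := by
  unfold PosOp.energy
  positivity

theorem PosOp.continuousOn_energy {S : Set ℝ} (hw : ContinuousOn w S) (hv : ContinuousOn v S) :
    ContinuousOn (fun r => A.energy (w r) (v r)) S :=
  ((hw.norm.pow 2).add (hv.norm.pow 2)).div_const 2

/-- `w`, with velocity `v`, solves `w_tt + A w + load = 0` weakly on `[a, b]`. The lower-order
terms are given by a `V'`-valued function, `load r φ` being its value at the time `r` tested
against `φ ∈ V`; the equation is integrated in time. -/
structure IsWeakSol (A : PosOp H) (load : ℝ → A.V → ℝ) (a b : ℝ) (w : ℝ → A.V) (v : ℝ → H) :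
    Prop where
  cont_w : ContinuousOn w (Icc a b)
  cont_v : ContinuousOn v (Icc a b)
  deriv : ∀ s ∈ Icc a b, HasDerivWithinAt (fun r => A.incl (w r)) (v s) (Icc a b) s
  eqn : ∀ φ : A.V, ∀ s ∈ Icc a b, ⟪v s, A.incl φ⟫ - ⟪v a, A.incl φ⟫ +
    ∫ r in a..s, (⟪w r, φ⟫ + load r φ) = 0

namespace IsWeakSol

variable {load : ℝ → A.V → ℝ}

theorem mono_right (hsol : IsWeakSol A load a b w v) (hcb : c ≤ b) :
    IsWeakSol A load a c w v :=
  have hsub : Icc a c ⊆ Icc a b := Icc_subset_Icc_right hcb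
  { cont_w := hsol.cont_w.mono hsub
    cont_v := hsol.cont_v.mono hsub
    deriv := fun s hs => (hsol.deriv s (hsub hs)).mono hsub
    eqn := fun φ s hs => hsol.eqn φ s (hsub hs) }

theorem inner_sub_eq_neg_integral (hsol : IsWeakSol A load a b w v)
    (hload : ∀ φ, IntervalIntegrable (load · φ) volume a b) {r : ℝ} (hr : r ∈ Icc a b)
    (hs : s ∈ Icc a b) (φ : A.V) :
    ⟪v s, A.incl φ⟫ - ⟪v r, A.incl φ⟫ = -∫ x in r..s, (⟪w x, φ⟫ + load x φ) := by
  have hab : uIcc a b = Icc a b := uIcc_of_le (hr.1.trans hr.2)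
  have hw : IntervalIntegrable (fun x => ⟪w x, φ⟫) volume a b :=
    (hab ▸ hsol.cont_w.inner continuousOn_const).intervalIntegrable
  have hint : ∀ x ∈ Icc a b, IntervalIntegrable (fun x => ⟪w x, φ⟫ + load x φ) volume a x :=
    fun x hx => (hw.add (hload φ)).mono_set
      (uIcc_subset_uIcc left_mem_uIcc (hab ▸ hx))
  rw [← intervalIntegral.integral_interval_sub_left (hint s hs) (hint r hr)]
  linarith [hsol.eqn φ s hs, hsol.eqn φ r hr]

theorem inner_diffQuot_add_inner_diffQuot (hsol : IsWeakSol A load a b w v)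
    (hload : ∀ φ, IntervalIntegrable (load · φ) volume a b) (hh : 0 < h) (hs : s ∈ Icc a b)
    (hsh : s + h ≤ b) (φ : A.V) :
    ⟪diffQuot h (fun r => ∫ x in a..r, w x) s, φ⟫ + ⟪diffQuot h v s, A.incl φ⟫ =
      -⨍ ρ in Ioc 0 h, load (s + ρ) φ := by
  have hsh' : s + h ∈ Icc a b := ⟨by linarith [hs.1], hsh⟩
  have hab : uIcc a b = Icc a b := uIcc_of_le (hs.1.trans hs.2)
  have hw : IntervalIntegrable w volume a b := (hab ▸ hsol.cont_w).intervalIntegrable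
  have hsub : ∀ x ∈ Icc a b, ∀ y ∈ Icc a b, uIcc x y ⊆ uIcc a b := fun x hx y hy =>
    uIcc_subset_uIcc (hab ▸ hx) (hab ▸ hy)
  have ha : a ∈ Icc a b := left_mem_Icc.2 (hs.1.trans hs.2)
  have hwI : IntervalIntegrable w volume s (s + h) := hw.mono_set (hsub s hs _ hsh')
  have hwφ : IntervalIntegrable (fun x => ⟪w x, φ⟫) volume s (s + h) :=
    ⟨hwI.1.inner_const φ, hwI.2.inner_const φ⟩
  have hprim : ⟪(∫ x in a..s + h, w x) - ∫ x in a..s, w x, φ⟫ = ∫ x in s..s + h, ⟪w x, φ⟫ := by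
    rw [intervalIntegral.integral_interval_sub_left (hw.mono_set (hsub a ha _ hsh'))
      (hw.mono_set (hsub a ha s hs)), real_inner_comm,
      ← innerSL_apply_apply ℝ, ← ContinuousLinearMap.intervalIntegral_comp_comm _ hwI]
    simp only [innerSL_apply_apply, real_inner_comm]
  have havg : ⨍ ρ in Ioc 0 h, load (s + ρ) φ = h⁻¹ * ∫ x in s..s + h, load x φ := by
    rw [setAverage_eq, ← intervalIntegral.integral_of_le hh.le,
      intervalIntegral.integral_comp_add_left (load · φ), add_zero]
    simp [hh.le]
  have heqn := hsol.inner_sub_eq_neg_integral hload hs hsh' φ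
  rw [intervalIntegral.integral_add hwφ ((hload φ).mono_set (hsub s hs _ hsh')), ← hprim,
    inner_sub_left] at heqn
  simp only [diffQuot, real_inner_smul_left, inner_sub_left, havg]
  linear_combination h⁻¹ * heqn

theorem energy_diffQuot_sub (hsol : IsWeakSol A load a b w v)
    (hload : ∀ φ, IntervalIntegrable (load · φ) volume a b) (hh : 0 < h) (hac : a ≤ c)
    (hch : c + h ≤ b) :
    A.energy (diffQuot h (fun r => ∫ x in a..r, w x) c) (diffQuot h (fun r => A.incl (w r)) c) -
      A.energy (diffQuot h (fun r => ∫ x in a..r, w x) a) (diffQuot h (fun r => A.incl (w r)) a) =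
      -∫ s in Ioc a c, ⨍ ρ in Ioc 0 h, load (s + ρ) (diffQuot h w s) := by
  set W := diffQuot h fun r => ∫ x in a..r, w x
  set V := diffQuot h fun r => A.incl (w r)
  have hW : ∀ s ∈ Icc a c, HasDerivWithinAt W (diffQuot h w s) (Icc a c) s := fun s =>
    hasDerivWithinAt_diffQuot (fun _ => hasDerivWithinAt_integral_of_continuousOn hsol.cont_w)
      hh.le hch
  have hV : ∀ s ∈ Icc a c, HasDerivWithinAt V (diffQuot h v s) (Icc a c) s := fun s =>
    hasDerivWithinAt_diffQuot hsol.deriv hh.le hch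
  have hderiv : ∀ s ∈ Icc a c, HasDerivWithinAt (fun r => A.energy (W r) (V r))
      (⟪W s, diffQuot h w s⟫ + ⟪V s, diffQuot h v s⟫) (Icc a c) s := fun s hs => by
    refine (((hW s hs).norm_sq.add (hV s hs).norm_sq).div_const 2).congr_deriv ?_
    ring
  have hcont : ContinuousOn (fun s => ⟪W s, diffQuot h w s⟫ + ⟪V s, diffQuot h v s⟫) (Icc a c) :=
    (ContinuousOn.inner (fun s hs => (hW s hs).continuousWithinAt)
      (continuousOn_diffQuot hsol.cont_w hh.le hch)).add
      (ContinuousOn.inner (fun s hs => (hV s hs).continuousWithinAt)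
        (continuousOn_diffQuot hsol.cont_v hh.le hch))
  rw [← intervalIntegral.integral_eq_sub_of_hasDeriv_right_of_le hac
    (fun s hs => (hderiv s hs).continuousWithinAt)
    (fun s hs => (hderiv s (Ioo_subset_Icc_self hs)).mono_of_mem_nhdsWithin
      (mem_of_superset (Ioc_mem_nhdsGT hs.2) fun r hr => ⟨hs.1.le.trans hr.1.le, hr.2⟩))
    (hcont.intervalIntegrable_of_Icc hac), intervalIntegral.integral_of_le hac, ← integral_neg]
  refine setIntegral_congr_fun measurableSet_Ioc fun s hs => ?_
  have hsb : s ∈ Icc a b := ⟨hs.1.le, by linarith [hs.2]⟩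
  rw [← hsol.inner_diffQuot_add_inner_diffQuot hload hh hsb (by linarith [hs.2]) (diffQuot h w s),
    map_diffQuot, real_inner_comm (diffQuot h v s)]

theorem tendsto_energy_diffQuot (hsol : IsWeakSol A load a b w v) (hcb : c < b)
    (hs : s ∈ Icc a c) :
    Tendsto (fun h => A.energy (diffQuot h (fun r => ∫ x in a..r, w x) s)
      (diffQuot h (fun r => A.incl (w r)) s)) (𝓝[>] 0) (𝓝 (A.energy (w s) (v s))) := by
  have hW := (tendstoUniformlyOn_diffQuot
    (fun _ => hasDerivWithinAt_integral_of_continuousOn hsol.cont_w) hsol.cont_w hcb).tendsto_at hs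
  have hV := (tendstoUniformlyOn_diffQuot hsol.deriv hsol.cont_v hcb).tendsto_at hs
  exact ((hW.norm.pow 2).add (hV.norm.pow 2)).div_const 2

variable {U : Type*} [NormedAddCommGroup U] [InnerProductSpace ℝ U] {N : ℝ → A.V →L[ℝ] U}
  {g z : ℝ → U}

theorem energy_sub_energy_of_lt
    (hsol : IsWeakSol A (fun r φ => ⟪g r, N r φ⟫) a b w v) (hac : a ≤ c) (hcb : c < b)
    (hN : GraphUniformContinuousOn N A.incl (Icc a b))
    (hg : MemLp g 2 (volume.restrict (Ioc a b))) (hz : MemLp z 2 (volume.restrict (Ioc a c)))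
    (hlim : Tendsto (fun h => eLpNorm (fun s => N s (diffQuot h w s) - z s) 2
      (volume.restrict (Ioc a c))) (𝓝[>] 0) (𝓝 0)) :
    A.energy (w c) (v c) - A.energy (w a) (v a) = -∫ s in a..c, ⟪g s, z s⟫ := by
  have hsmall : ∀ᶠ h : ℝ in 𝓝[>] 0, h ∈ Ioo 0 (b - c) := Ioo_mem_nhdsGT (sub_pos.2 hcb)
  have hload : ∀ φ, IntervalIntegrable (fun r => ⟪g r, N r φ⟫) volume a b := fun φ =>
    (intervalIntegrable_iff_integrableOn_Ioc_of_le (hac.trans hcb.le)).2 <| integrable_inner hg <|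
      memLp_restrict_of_continuousOn isCompact_Icc (hN.continuousOn.clm_apply continuousOn_const)
        measurableSet_Ioc Ioc_subset_Icc_self
  obtain ⟨M, hM⟩ := isCompact_Icc.exists_bound_of_continuousOn hsol.cont_v
  have hbound : ∀ᶠ h in 𝓝[>] (0 : ℝ), ∀ s ∈ Icc a c, ‖A.incl (diffQuot h w s)‖ ≤ M + 1 := by
    filter_upwards [Metric.tendstoUniformlyOn_iff.1
      (tendstoUniformlyOn_diffQuot hsol.deriv hsol.cont_v hcb) 1 one_pos] with h hh s hs
    rw [map_diffQuot]
    have hdist := hh s hs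
    rw [dist_comm, dist_eq_norm] at hdist
    have hvM := hM s (Icc_subset_Icc_right hcb.le hs)
    linarith [norm_sub_norm_le (diffQuot h (fun r => A.incl (w r)) s) (v s)]
  have hdiss := hN.tendsto_integral_average hcb
    (hsmall.mono fun h hh => continuousOn_diffQuot hsol.cont_w hh.1.le (by linarith [hh.2]))
    hbound hg hz hlim
  have henergy := (hsol.tendsto_energy_diffQuot hcb (right_mem_Icc.2 hac)).sub
    (hsol.tendsto_energy_diffQuot hcb (left_mem_Icc.2 hac))
  rw [intervalIntegral.integral_of_le hac]
  refine tendsto_nhds_unique henergy (hdiss.neg.congr' ?_)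
  filter_upwards [hsmall] with h hh
  exact (hsol.energy_diffQuot_sub hload hh.1 hac (by linarith [hh.2])).symm

theorem energy_sub_energy
    (hsol : IsWeakSol A (fun r φ => ⟪g r, N r φ⟫) a b w v) (hab : a < b)
    (hN : ∀ c < b, GraphUniformContinuousOn N A.incl (Icc a c))
    (hg : MemLp g 2 (volume.restrict (Ioc a b))) (hz : MemLp z 2 (volume.restrict (Ioc a b)))
    (hlim : ∀ c < b, Tendsto (fun h => eLpNorm (fun s => N s (diffQuot h w s) - z s) 2
      (volume.restrict (Ioc a c))) (𝓝[>] 0) (𝓝 0)) (hc : c ∈ Icc a b) :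
    A.energy (w c) (v c) - A.energy (w a) (v a) = -∫ s in a..c, ⟪g s, z s⟫ := by
  have hmono : ∀ {f : ℝ → U} {d : ℝ}, MemLp f 2 (volume.restrict (Ioc a b)) → d ≤ b →
      MemLp f 2 (volume.restrict (Ioc a d)) := fun hf hd =>
    hf.mono_measure (Measure.restrict_mono (Ioc_subset_Ioc_right hd) le_rfl)
  have hlt : EqOn (fun c => A.energy (w c) (v c) - A.energy (w a) (v a))
      (fun c => -∫ s in a..c, ⟪g s, z s⟫) (Ico a b) := fun c hc => by
    obtain ⟨d, hcd, hdb⟩ := exists_between hc.2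
    exact (hsol.mono_right hdb.le).energy_sub_energy_of_lt hc.1 hcd (hN d hdb) (hmono hg hdb.le)
      (hmono hz hc.2.le) (hlim c hc.2)
  have hint : IntegrableOn (fun s => ⟪g s, z s⟫) (Icc a b) :=
    by rw [integrableOn_Icc_iff_integrableOn_Ioc]; exact integrable_inner hg hz
  refine hlt.of_subset_closure ((PosOp.continuousOn_energy hsol.cont_w hsol.cont_v).sub
    continuousOn_const) (ContinuousOn.neg ?_) Ico_subset_Icc_self (closure_Ico hab.ne).ge hc
  rw [← uIcc_of_le hab.le] at hint ⊢
  exact intervalIntegral.continuousOn_primitive_interval hint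

end IsWeakSol

end WeakSolution

section EnergyEstimates

variable {H : Type*} [NormedAddCommGroup H] [InnerProductSpace ℝ H] [CompleteSpace H]
  {U : Type*} [NormedAddCommGroup U] [InnerProductSpace ℝ U]
  {A : PosOp H} {a b c d s : ℝ} {w : ℝ → A.V} {v : ℝ → H} {g : ℝ → U}

section Damped

variable [CompleteSpace U] {B₁ : ℝ → U →L[ℝ] StrongDual ℝ A.V}

theorem IsDampedSol.isWeakSol (hsol : IsDampedSol A B₁ a b w v g) :
    IsWeakSol A (fun r φ => ⟪g r, dualOp (B₁ r) φ⟫) a b w v :=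
  { hsol with }

theorem IsDampingTrace.tendsto_eLpNorm (htr : IsDampingTrace B₁ a b w g) (hcb : c < b) :
    Tendsto (fun h => eLpNorm (fun s => dualOp (B₁ s) (diffQuot h w s) - g s) 2
      (volume.restrict (Ioc a c))) (𝓝[>] 0) (𝓝 0) := by
  refine tendsto_eLpNorm_two_of_tendsto_lintegral ?_
  refine tendsto_of_tendsto_of_tendsto_of_le_of_le' tendsto_const_nhds htr.2
    (Eventually.of_forall fun _ => zero_le) ?_
  filter_upwards [Ioo_mem_nhdsGT (sub_pos.2 hcb)] with h hh
  simp only [diffQuot, map_smul]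
  exact lintegral_mono_set (Ioc_subset_Ioc_right (by linarith [hh.2]))

theorem IsDampedSol.energy_sub_energy (hsol : IsDampedSol A B₁ a b w v g) (hab : a < b)
    (hB₁ : ∀ c < b, GraphUniformContinuousOn (fun r => dualOp (B₁ r)) A.incl (Icc a c))
    (hc : c ∈ Icc a b) :
    A.energy (w c) (v c) - A.energy (w a) (v a) = -∫ s in a..c, ‖g s‖ ^ 2 := by
  simp only [← real_inner_self_eq_norm_sq]
  exact hsol.isWeakSol.energy_sub_energy hab hB₁ hsol.trace.1 hsol.trace.1
    (fun _ => hsol.trace.tendsto_eLpNorm) hc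

theorem IsDampedSol.energy_le (hsol : IsDampedSol A B₁ a b w v g) (hab : a < b)
    (hB₁ : ∀ c < b, GraphUniformContinuousOn (fun r => dualOp (B₁ r)) A.incl (Icc a c))
    (hc : c ∈ Icc a b) : A.energy (w c) (v c) ≤ A.energy (w a) (v a) := by
  have hnonneg : 0 ≤ ∫ s in a..c, ‖g s‖ ^ 2 :=
    intervalIntegral.integral_nonneg hc.1 fun _ _ => sq_nonneg _
  linarith [hsol.energy_sub_energy hab hB₁ hc]

theorem IsDampedSol.energy_le_of_observable (hsol : IsDampedSol A B₁ a b w v g) (hab : a < b)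
    (hB₁ : ∀ c < b, GraphUniformContinuousOn (fun r => dualOp (B₁ r)) A.incl (Icc a c))
    (hd : 0 ≤ d) (hobs : Observable A B₁ a b (b - a) d) :
    A.energy (w b) (v b) ≤ d / (d + 1) * A.energy (w a) (v a) := by
  have hE := hsol.energy_sub_energy hab hB₁ (right_mem_Icc.2 hab.le)
  have hO := hobs w v g hsol
  rw [add_sub_cancel, ← neg_eq_iff_eq_neg.2 hE] at hO
  rw [div_mul_eq_mul_div, le_div_iff₀ (by linarith)]
  linarith

end Damped

section Bounded

variable {F : ℝ → H →L[ℝ] U} {K E₀ : ℝ}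

theorem IsWeakSol.tendsto_eLpNorm_comp_diffQuot {load : ℝ → A.V → ℝ}
    (hsol : IsWeakSol A load a b w v) (hF : ContinuousOn F (Icc a b)) (hcb : c < b) :
    Tendsto (fun h => eLpNorm (fun s => (F s ∘L A.incl) (diffQuot h w s) - F s (v s)) 2
      (volume.restrict (Ioc a c))) (𝓝[>] 0) (𝓝 0) := by
  refine tendsto_eLpNorm_sub_of_tendstoUniformlyOn
    ((ae_restrict_mem measurableSet_Ioc).mono fun _ hs => Ioc_subset_Icc_self hs) ?_
  obtain ⟨M, hM⟩ := isCompact_Icc.exists_bound_of_continuousOn hF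
  refine Metric.tendstoUniformlyOn_iff.2 fun ε hε => ?_
  filter_upwards [Metric.tendstoUniformlyOn_iff.1
    (tendstoUniformlyOn_diffQuot hsol.deriv hsol.cont_v hcb) (ε / (|M| + 1)) (by positivity)]
    with h hh s hs
  rw [ContinuousLinearMap.comp_apply, map_diffQuot, dist_eq_norm, ← map_sub]
  have hFs : ‖F s‖ ≤ |M| + 1 := by
    linarith [hM s (Icc_subset_Icc_right hcb.le hs), le_abs_self M]
  calc ‖F s (v s - diffQuot h (fun r => A.incl (w r)) s)‖
      ≤ (|M| + 1) * dist (v s) (diffQuot h (fun r => A.incl (w r)) s) := by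
        rw [dist_eq_norm]
        exact (F s).le_of_opNorm_le hFs _
    _ < ε := by rw [← lt_div_iff₀' (by positivity)]; exact hh s hs

theorem IsWeakSol.energy_sub_energy_of_bounded
    (hsol : IsWeakSol A (fun r φ => ⟪g r, F r (A.incl φ)⟫) a b w v) (hab : a < b)
    (hF : ContinuousOn F (Icc a b)) (hg : MemLp g 2 (volume.restrict (Ioc a b)))
    (hc : c ∈ Icc a b) :
    A.energy (w c) (v c) - A.energy (w a) (v a) = -∫ s in a..c, ⟪g s, F s (v s)⟫ :=
  IsWeakSol.energy_sub_energy (N := fun r => F r ∘L A.incl) hsol hab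
    (fun _ hc => graphUniformContinuousOn_of_comp isCompact_Icc
      (hF.mono (Icc_subset_Icc_right hc.le)) _) hg
    (memLp_restrict_of_continuousOn isCompact_Icc (hF.clm_apply hsol.cont_v) measurableSet_Ioc
      Ioc_subset_Icc_self)
    (fun _ => hsol.tendsto_eLpNorm_comp_diffQuot hF) hc

theorem PosOp.sq_norm_le_two_mul_energy (A : PosOp H) (u : A.V) (v : H) :
    ‖v‖ ^ 2 ≤ 2 * A.energy u v := by
  unfold PosOp.energy
  linarith [sq_nonneg ‖u‖]

theorem IsWeakSol.energy_add_le
    (hsol : IsWeakSol A (fun r φ => ⟪g r, F r (A.incl φ)⟫) a b w v) (hab : a < b)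
    (hF : ContinuousOn F (Icc a b)) (hg : ContinuousOn g (Icc a b)) (hK0 : 0 ≤ K)
    (hK : ∀ s ∈ Ico a b, ∀ x, ‖F s x‖ ^ 2 ≤ K * ‖x‖ ^ 2)
    (hgE : ∀ s ∈ Ico a b, ‖g s‖ ^ 2 ≤ K * (2 * E₀)) (hs : s ∈ Icc a b) :
    A.energy (w s) (v s) + E₀ ≤ (A.energy (w a) (v a) + E₀) * Real.exp (K * (s - a)) := by
  have hgL : MemLp g 2 (volume.restrict (Ioc a b)) :=
    memLp_restrict_of_continuousOn isCompact_Icc hg measurableSet_Ioc Ioc_subset_Icc_self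
  have hderiv : ∀ r ∈ Ico a b, HasDerivWithinAt (fun r => A.energy (w r) (v r) + E₀)
      (-⟪g r, F r (v r)⟫) (Ici r) r := fun r hr => by
    have hr' := Ico_subset_Icc_self hr
    refine HasDerivWithinAt.mono_of_mem_nhdsWithin (HasDerivWithinAt.congr_of_mem
      ((hasDerivWithinAt_integral_of_continuousOn (hg.inner (hF.clm_apply hsol.cont_v))
        hr').const_sub (A.energy (w a) (v a) + E₀)) (fun c hc => ?_) hr')
      (mem_of_superset (Icc_mem_nhdsGE hr.2) (Icc_subset_Icc_left hr.1))
    linarith [hsol.energy_sub_energy_of_bounded hab hF hgL hc]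
  rw [← gronwallBound_ε0]
  refine le_gronwallBound_of_liminf_deriv_right_le (f := fun r => A.energy (w r) (v r) + E₀)
    ((PosOp.continuousOn_energy hsol.cont_w hsol.cont_v).add continuousOn_const)
    (fun r hr x hx => ((hderiv r hr).liminf_right_slope_le hx).mono fun z hz => by
      simpa only [slope_def_module, smul_eq_mul] using hz) le_rfl (fun r hr => ?_) s hs
  have hcs : -⟪g r, F r (v r)⟫ ≤ ‖g r‖ * ‖F r (v r)‖ :=
    (neg_le_abs _).trans (abs_real_inner_le_norm _ _)
  have hv := mul_le_mul_of_nonneg_left (A.sq_norm_le_two_mul_energy (w r) (v r)) hK0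
  linarith [two_mul_le_add_sq ‖g r‖ ‖F r (v r)‖, hK r hr (v r), hgE r hr]

end Bounded

end EnergyEstimates

/-! ### Regularity of the damping and delay operators -/

section Regularity

variable {H : Type*} [NormedAddCommGroup H] [InnerProductSpace ℝ H] [CompleteSpace H]
  {U : Type*} [NormedAddCommGroup U] [InnerProductSpace ℝ U] [CompleteSpace U]
  {A : PosOp H} {B₁ : ℝ → U →L[ℝ] StrongDual ℝ A.V} {B₂ : ℝ → U →L[ℝ] H} {a b : ℝ}

theorem dualOp_pivot_comp (F : U →L[ℝ] H) : dualOp (A.pivot ∘L F) = F.adjoint ∘L A.incl := by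
  ext v
  refine ext_inner_right ℝ fun x => ?_
  rw [dualOp_inner, ContinuousLinearMap.comp_apply, ContinuousLinearMap.comp_apply,
    ContinuousLinearMap.adjoint_inner_left, A.pivot_apply, real_inner_comm]

theorem dualOp_smul (c : ℝ) (B : U →L[ℝ] StrongDual ℝ A.V) : dualOp (c • B) = c • dualOp B := by
  ext v
  refine ext_inner_right ℝ fun x => ?_
  rw [_root_.smul_apply, real_inner_smul_left, dualOp_inner, dualOp_inner]
  rfl

theorem dualOp_zero : dualOp (0 : U →L[ℝ] StrongDual ℝ A.V) = 0 := by
  ext v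
  refine ext_inner_right ℝ fun x => ?_
  rw [dualOp_inner]
  simp only [_root_.zero_apply, inner_zero_left]

theorem continuousOn_adjoint {F : ℝ → U →L[ℝ] H} {s : Set ℝ} (hF : ContinuousOn F s) :
    ContinuousOn (fun r => (F r).adjoint) s :=
  (ContinuousLinearMap.adjoint (𝕜 := ℝ) (E := U) (F := H)).continuous.comp_continuousOn hF

/-- The time regularity of the undelayed damping on `[a, b)` under which the energy identity
holds. Near `b`, where `B₁` may degenerate, only weak boundedness of `B₁(s)*` is asked for; it
makes the damping term in the weak equation integrable up to `b`. -/
structure AdmissibleDamping (A : PosOp H) (B₁ : ℝ → U →L[ℝ] StrongDual ℝ A.V) (a b : ℝ) :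
    Prop where
  graph : ∀ c < b, GraphUniformContinuousOn (fun r => dualOp (B₁ r)) A.incl (Icc a c)
  bounded : ∀ φ, ∃ M, ∀ s ∈ Ico a b, ‖dualOp (B₁ s) φ‖ ≤ M

theorem AdmissibleDamping.of_continuousOn {F : ℝ → U →L[ℝ] H} (hF : ContinuousOn F (Icc a b))
    (hB₁ : ∀ s ∈ Ico a b, B₁ s = A.pivot ∘L F s) : AdmissibleDamping A B₁ a b where
  graph c hc := (graphUniformContinuousOn_of_comp isCompact_Icc
    (continuousOn_adjoint (hF.mono (Icc_subset_Icc_right hc.le))) A.incl).congr fun s hs => by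
      rw [hB₁ s ⟨hs.1, hs.2.trans_lt hc⟩, dualOp_pivot_comp]
  bounded φ := by
    obtain ⟨M, hM⟩ := isCompact_Icc.exists_bound_of_continuousOn
      ((continuousOn_adjoint hF).clm_apply (continuousOn_const (c := A.incl φ)))
    refine ⟨M, fun s hs => ?_⟩
    rw [hB₁ s hs, dualOp_pivot_comp]
    exact hM s (Ico_subset_Icc_self hs)

theorem AdmissibleDamping.of_smul {α : ℝ → ℝ} {L : U →L[ℝ] StrongDual ℝ A.V}
    (hα : ContinuousOn α (Icc a b)) (hpos : ∀ s ∈ Ico a b, 0 < α s)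
    (hB₁ : ∀ s ∈ Ico a b, B₁ s = α s • L) : AdmissibleDamping A B₁ a b where
  graph c hc := by
    have hsub : Icc a c ⊆ Ico a b := fun s hs => ⟨hs.1, hs.2.trans_lt hc⟩
    exact (graphUniformContinuousOn_smul isCompact_Icc (hα.mono (Icc_subset_Icc_right hc.le))
      (fun s hs => hpos s (hsub hs)) (dualOp L) A.incl).congr fun s hs => by
        rw [hB₁ s (hsub hs), dualOp_smul]
  bounded φ := by
    obtain ⟨M, hM⟩ := isCompact_Icc.exists_bound_of_continuousOn
      (hα.smul (continuousOn_const (c := dualOp L φ)))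
    refine ⟨M, fun s hs => ?_⟩
    rw [hB₁ s hs, dualOp_smul]
    exact hM s (Ico_subset_Icc_self hs)

theorem RegularB₁.admissibleDamping (h : RegularB₁ A B₁ a b) : AdmissibleDamping A B₁ a b := by
  rcases h with ⟨F, hF, hB₁⟩ | ⟨β, L, ⟨β', K, hβ, -⟩, hpos, hB₁⟩
  · exact .of_continuousOn hF.continuousOn hB₁
  · exact .of_smul (ContinuousOn.sqrt fun s hs => (hβ s hs).continuousWithinAt)
      (fun s hs => Real.sqrt_pos.2 (hpos s hs)) hB₁

theorem AdmissibleDamping.intervalIntegrable (h : AdmissibleDamping A B₁ a b) (hab : a ≤ b)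
    {g : ℝ → U} (hg : MemLp g 2 (volume.restrict (Ioc a b))) (φ : A.V) :
    IntervalIntegrable (fun r => ⟪g r, dualOp (B₁ r) φ⟫) volume a b := by
  have hcont : ContinuousOn (fun r => dualOp (B₁ r) φ) (Ioo a b) := fun r hr => by
    obtain ⟨c, hrc, hcb⟩ := exists_between hr.2
    exact (((h.graph c hcb).continuousOn.clm_apply continuousOn_const).continuousAt
      (Icc_mem_nhds hr.1 hrc)).continuousWithinAt
  obtain ⟨M, hM⟩ := h.bounded φ
  rw [intervalIntegrable_iff_integrableOn_Ioo_of_le hab]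
  refine integrable_inner
    (hg.mono_measure (Measure.restrict_mono Ioo_subset_Ioc_self le_rfl)) ?_
  exact MemLp.of_bound (hcont.aestronglyMeasurable measurableSet_Ioo) M
    ((ae_restrict_mem measurableSet_Ioo).mono fun s hs => hM s (Ioo_subset_Ico_self hs))

theorem RegularB₂.intervalIntegrable (h : RegularB₂ B₂ a b) (hab : a ≤ b) {p : ℝ → H}
    (hp : ContinuousOn p (Icc a b)) (x : H) :
    IntervalIntegrable (fun r => ⟪(B₂ r).adjoint (p r), (B₂ r).adjoint x⟫) volume a b := by
  obtain ⟨F, hF, hB₂⟩ := h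
  have hF' := continuousOn_adjoint hF
  refine (((hF'.clm_apply hp).inner (hF'.clm_apply
    (continuousOn_const (c := x)))).intervalIntegrable_of_Icc hab).congr_uIoo fun s hs => ?_
  rw [uIoo_of_le hab] at hs
  simp only [hB₂ s (Ioo_subset_Ico_self hs)]

end Regularity

section Restriction

variable {H : Type*} [NormedAddCommGroup H] [InnerProductSpace ℝ H] [CompleteSpace H]
  {A : PosOp H} {a b c : ℝ} {w : ℝ → A.V} {v : ℝ → H} {load load' : ℝ → A.V → ℝ}

theorem IsWeakSol.mono_left (hsol : IsWeakSol A load a b w v) (hac : a ≤ c) (hcb : c ≤ b)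
    (hload : ∀ φ, IntervalIntegrable (load · φ) volume a b) : IsWeakSol A load c b w v :=
  have hsub : Icc c b ⊆ Icc a b := Icc_subset_Icc_left hac
  { cont_w := hsol.cont_w.mono hsub
    cont_v := hsol.cont_v.mono hsub
    deriv := fun s hs => (hsol.deriv s (hsub hs)).mono hsub
    eqn := fun φ s hs => by
      rw [hsol.inner_sub_eq_neg_integral hload ⟨hac, hcb⟩ (hsub hs), neg_add_cancel] }

theorem IsWeakSol.congr (hsol : IsWeakSol A load a b w v)
    (hload : ∀ s ∈ Ioo a b, load s = load' s) : IsWeakSol A load' a b w v :=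
  { hsol with
    eqn := fun φ s hs => by
      rw [← hsol.eqn φ s hs]
      congr 1
      refine intervalIntegral.integral_congr_Ioo_of_le hs.1 fun r hr => ?_
      simp only [hload r ⟨hr.1, hr.2.trans_le hs.2⟩] }

variable {U₁ : Type*} [NormedAddCommGroup U₁] [InnerProductSpace ℝ U₁] [CompleteSpace U₁]
  {U₂ : Type*} [NormedAddCommGroup U₂] [InnerProductSpace ℝ U₂] [CompleteSpace U₂]
  {B₁ : ℝ → U₁ →L[ℝ] StrongDual ℝ A.V} {B₂ : ℝ → U₂ →L[ℝ] H} {τ : ℝ} {t : ℕ → ℝ} {u : ℝ → A.V}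

theorem IsSol.exists_trace_isWeakSol (hsol : IsSol A B₁ B₂ τ t u v) :
    ∃ g : ℝ → U₁, (∀ n, IsDampingTrace B₁ (t (2 * n)) (t (2 * n + 1)) u g) ∧
      ∀ b, IsWeakSol A (fun r φ => ⟪g r, dualOp (B₁ r) φ⟫ +
        ⟪(B₂ r).adjoint (v (r - τ)), (B₂ r).adjoint (A.incl φ)⟫) 0 b u v := by
  obtain ⟨g, htr, heqn⟩ := hsol.eqn
  refine ⟨g, htr, fun b => ?_⟩
  have hsub : Icc 0 b ⊆ Ici 0 := Icc_subset_Ici_self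
  refine ⟨hsol.cont_u.mono hsub, hsol.cont_v.mono hsub,
    fun s hs => (hsol.deriv s (hsub hs)).mono hsub, fun φ s hs => ?_⟩
  simpa only [add_assoc] using heqn φ s (hsub hs)

theorem IsWeakSol.restrict_of_monotone (hsol : ∀ b, IsWeakSol A load 0 b u v) (ht0 : t 0 = 0)
    (ht : Monotone t)
    (hload : ∀ n φ, IntervalIntegrable (load · φ) volume (t n) (t (n + 1))) (n : ℕ) :
    IsWeakSol A load (t n) (t (n + 1)) u v :=
  (hsol _).mono_left (ht0 ▸ ht n.zero_le) (ht n.le_succ) fun φ =>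
    ht0 ▸ IntervalIntegrable.trans_iterate fun k _ => hload k φ

theorem IsSol.exists_isDampedSol_isWeakSol (hsol : IsSol A B₁ B₂ τ t u v) (ht0 : t 0 = 0)
    (ht : Monotone t) (hτ : τ ≤ t 1)
    (hB₂ : ∀ n, ∀ s ∈ Ico (t (2 * n)) (t (2 * n + 1)), B₂ s = 0)
    (hB₁ : ∀ n, ∀ s ∈ Ico (t (2 * n + 1)) (t (2 * n + 2)), B₁ s = 0)
    (hadm : ∀ n, AdmissibleDamping A B₁ (t (2 * n)) (t (2 * n + 1)))
    (hreg : ∀ n, RegularB₂ B₂ (t (2 * n + 1)) (t (2 * n + 2))) :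
    ∃ g : ℝ → U₁, (∀ n, IsDampedSol A B₁ (t (2 * n)) (t (2 * n + 1)) u v g) ∧
      ∀ n, IsWeakSol A (fun r φ => ⟪(B₂ r).adjoint (v (r - τ)), (B₂ r).adjoint (A.incl φ)⟫)
        (t (2 * n + 1)) (t (2 * n + 2)) u v := by
  obtain ⟨g, htr, hweak⟩ := hsol.exists_trace_isWeakSol
  set load : ℝ → A.V → ℝ := fun r φ => ⟪g r, dualOp (B₁ r) φ⟫ +
    ⟪(B₂ r).adjoint (v (r - τ)), (B₂ r).adjoint (A.incl φ)⟫
  have heven : ∀ n, ∀ r ∈ Ioo (t (2 * n)) (t (2 * n + 1)),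
      load r = fun φ => ⟪g r, dualOp (B₁ r) φ⟫ := fun n r hr => by
    simp [load, hB₂ n r (Ioo_subset_Ico_self hr)]
  have hodd : ∀ n, ∀ r ∈ Ioo (t (2 * n + 1)) (t (2 * n + 2)),
      load r = fun φ => ⟪(B₂ r).adjoint (v (r - τ)), (B₂ r).adjoint (A.incl φ)⟫ :=
    fun n r hr => by simp [load, hB₁ n r (Ioo_subset_Ico_self hr), dualOp_zero]
  have hload : ∀ n φ, IntervalIntegrable (load · φ) volume (t n) (t (n + 1)) := by
    intro n φ
    have hle := ht n.le_succ
    obtain ⟨m, rfl | rfl⟩ := n.even_or_odd'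
    · refine ((hadm m).intervalIntegrable hle (htr m).1 φ).congr_uIoo fun r hr => ?_
      rw [heven m r (uIoo_of_le hle ▸ hr)]
    · have hv : ContinuousOn (fun r => v (r - τ)) (Icc (t (2 * m + 1)) (t (2 * m + 2))) :=
        hsol.cont_v.comp (by fun_prop) fun r hr =>
          sub_nonneg.2 (hτ.trans ((ht (by lia)).trans hr.1))
      refine ((hreg m).intervalIntegrable hle hv (A.incl φ)).congr_uIoo fun r hr => ?_
      rw [hodd m r (uIoo_of_le hle ▸ hr)]
  have hres := IsWeakSol.restrict_of_monotone hweak ht0 ht hload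
  refine ⟨g, fun n => ?_, fun n => (hres (2 * n + 1)).congr (hodd n)⟩
  exact { (hres (2 * n)).congr (heven n) with trace := htr n }

end Restriction

/-! ### Decay over one cycle and in time -/

section Decay

variable {H : Type*} [NormedAddCommGroup H] [InnerProductSpace ℝ H] [CompleteSpace H]
  {U₁ : Type*} [NormedAddCommGroup U₁] [InnerProductSpace ℝ U₁] [CompleteSpace U₁]
  {U₂ : Type*} [NormedAddCommGroup U₂] [InnerProductSpace ℝ U₂] [CompleteSpace U₂]
  {A : PosOp H} {B₁ : ℝ → U₁ →L[ℝ] StrongDual ℝ A.V} {B₂ : ℝ → U₂ →L[ℝ] H}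
  {a b c d s τ K E₀ : ℝ} {w : ℝ → A.V} {v p : ℝ → H} {g : ℝ → U₁}

theorem IsWeakSol.energy_add_le_of_regularB₂
    (hsol : IsWeakSol A (fun r φ => ⟪(B₂ r).adjoint (p r), (B₂ r).adjoint (A.incl φ)⟫) a b w v)
    (hab : a < b) (hreg : RegularB₂ B₂ a b) (hp : ContinuousOn p (Icc a b)) (hK0 : 0 ≤ K)
    (hK : ∀ s ∈ Ico a b, ∀ x, ‖(B₂ s).adjoint x‖ ^ 2 ≤ K * ‖x‖ ^ 2)
    (hpE : ∀ s ∈ Ico a b, ‖p s‖ ^ 2 ≤ 2 * E₀) (hs : s ∈ Icc a b) :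
    A.energy (w s) (v s) + E₀ ≤ (A.energy (w a) (v a) + E₀) * Real.exp (K * (s - a)) := by
  obtain ⟨F, hF, hB₂⟩ := hreg
  have hF' := continuousOn_adjoint hF
  have hweak : IsWeakSol A (fun r φ => ⟪(F r).adjoint (p r), (F r).adjoint (A.incl φ)⟫) a b w v :=
    hsol.congr fun r hr => by rw [hB₂ r (Ioo_subset_Ico_self hr)]
  refine hweak.energy_add_le hab hF' (hF'.clm_apply hp) hK0
    (fun r hr => hB₂ r hr ▸ hK r hr) (fun r hr => ?_) hs
  rw [← hB₂ r hr]
  exact (hK r hr _).trans (mul_le_mul_of_nonneg_left (hpE r hr) hK0)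

theorem energy_le_of_cycle (hab : a < b) (hbc : b < c) (hτ : τ ≤ b - a) (hτ' : c - b ≤ τ)
    (hdamp : IsDampedSol A B₁ a b w v g)
    (hdelay : IsWeakSol A
      (fun r φ => ⟪(B₂ r).adjoint (v (r - τ)), (B₂ r).adjoint (A.incl φ)⟫) b c w v)
    (hB₁ : ∀ r < b, GraphUniformContinuousOn (fun r => dualOp (B₁ r)) A.incl (Icc a r))
    (hB₂ : RegularB₂ B₂ b c) (hK0 : 0 ≤ K)
    (hK : ∀ s ∈ Ico b c, ∀ x, ‖(B₂ s).adjoint x‖ ^ 2 ≤ K * ‖x‖ ^ 2) (hd : 0 ≤ d)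
    (hobs : Observable A B₁ a b (b - a) d) (hs : s ∈ Icc b c) :
    A.energy (w s) (v s) ≤
      (Real.exp (K * (c - b)) * (d / (d + 1) + 1) - 1) * A.energy (w a) (v a) := by
  have hmaps : MapsTo (fun r => r - τ) (Icc b c) (Icc a b) := fun r hr =>
    ⟨by linarith [hr.1], by linarith [hr.2]⟩
  have hpast : ∀ r ∈ Ico b c, ‖v (r - τ)‖ ^ 2 ≤ 2 * A.energy (w a) (v a) := fun r hr =>
    (A.sq_norm_le_two_mul_energy _ _).trans <| mul_le_mul_of_nonneg_left
      (hdamp.energy_le hab hB₁ (hmaps (Ico_subset_Icc_self hr))) zero_le_two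
  have hgrowth := hdelay.energy_add_le_of_regularB₂ hbc hB₂
    (hdamp.cont_v.comp (by fun_prop) hmaps) hK0 hK hpast hs
  have hcontr := hdamp.energy_le_of_observable hab hB₁ hd hobs
  have hsum : A.energy (w s) (v s) + A.energy (w a) (v a) ≤
      (d / (d + 1) * A.energy (w a) (v a) + A.energy (w a) (v a)) * Real.exp (K * (c - b)) := by
    have hEa := A.energy_nonneg (w a) (v a)
    refine hgrowth.trans ?_
    gcongr
    exact hs.2
  linarith

theorem le_exp_mul_of_contraction {e : ℝ → ℝ} {T : ℕ → ℝ} {q P : ℝ} (hq0 : 0 < q) (hq1 : q < 1)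
    (hP : 0 < P) (hT0 : T 0 = 0) (hT : Monotone T) (hTP : ∀ n, T (n + 1) - T n ≤ P)
    (hTtop : ¬BddAbove (range T)) (he : ∀ n, ∀ s ∈ Icc (T n) (T (n + 1)), e s ≤ e (T n))
    (hc : ∀ n, e (T (n + 1)) ≤ q * e (T n)) (he0 : 0 ≤ e 0) (hs : 0 ≤ s) :
    e s ≤ q⁻¹ * Real.exp (-(-Real.log q / P) * s) * e 0 := by
  have hTn : ∀ n : ℕ, T n ≤ n * P := fun n => by
    induction n with
    | zero => simp [hT0]
    | succ n ih => push_cast; linarith [hTP n]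
  have hen : ∀ n, e (T n) ≤ q ^ n * e 0 := fun n => by
    simpa only [Function.comp_apply, hT0] using le_geom (u := e ∘ T) hq0.le n fun k _ => hc k
  obtain ⟨n, hn⟩ : ∃ n, s ∈ Ico (T n) (T (n + 1)) :=
    mem_iUnion.1 ((iUnion_Ico_map_succ_eq_Ici (fun n => hT n.zero_le) hTtop).ge
      (hT0.le.trans hs : T 0 ≤ s))
  refine ((he n s (Ico_subset_Icc_self hn)).trans (hen n)).trans ?_
  gcongr
  have hsP : s / P ≤ n + 1 := by
    rw [div_le_iff₀ hP]
    exact_mod_cast hn.2.le.trans (hTn (n + 1))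
  calc q ^ n = Real.exp (n * Real.log q) := by rw [Real.exp_nat_mul, Real.exp_log hq0]
    _ ≤ Real.exp (-Real.log q + s / P * Real.log q) := by
      gcongr
      linarith [mul_le_mul_of_nonpos_right hsP (Real.log_neg hq0 hq1).le]
    _ = q⁻¹ * Real.exp (-(-Real.log q / P) * s) := by
      rw [Real.exp_add, Real.exp_neg, Real.exp_log hq0]
      ring_nf

theorem not_bddAbove_range_of_le_sub {T : ℕ → ℝ} {δ : ℝ} (hδ : 0 < δ)
    (hT : ∀ n, δ ≤ T (n + 1) - T n) : ¬BddAbove (range T) := by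
  have hlin : ∀ n : ℕ, T 0 + n * δ ≤ T n := fun n => by
    induction n with
    | zero => simp
    | succ n ih => push_cast; linarith [hT n]
  have htop : Tendsto T atTop atTop := tendsto_atTop_mono hlin <|
    tendsto_atTop_add_const_left _ _ (tendsto_natCast_atTop_atTop.atTop_mul_const hδ)
  exact not_bddAbove_of_tendsto_atTop htop

end Decay

end DelayDamping

theorem theorem4p4_general
    {H : Type*} [NormedAddCommGroup H] [InnerProductSpace ℝ H] [CompleteSpace H]
    {U₁ : Type*} [NormedAddCommGroup U₁] [InnerProductSpace ℝ U₁] [CompleteSpace U₁]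
    {U₂ : Type*} [NormedAddCommGroup U₂] [InnerProductSpace ℝ U₂] [CompleteSpace U₂]
    (A : PosOp H) (B₁ : ℝ → U₁ →L[ℝ] StrongDual ℝ A.V) (B₂ : ℝ → U₂ →L[ℝ] H) (τ : ℝ)
    (t : ℕ → ℝ) (ht0 : t 0 = 0) (ht : StrictMono t)
    (hB₂ : ∀ n, ∀ s ∈ Ico (t (2 * n)) (t (2 * n + 1)), B₂ s = 0)
    (hB₁ : ∀ n, ∀ s ∈ Ico (t (2 * n + 1)) (t (2 * n + 2)), B₁ s = 0)
    (hadm : ∀ n, AdmissibleDamping A B₁ (t (2 * n)) (t (2 * n + 1)))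
    (hreg : ∀ n, RegularB₂ B₂ (t (2 * n + 1)) (t (2 * n + 2)))
    (K : ℕ → ℝ) (hK0 : ∀ n, 0 ≤ K n)
    (hK : ∀ n, ∀ s ∈ Ico (t (2 * n + 1)) (t (2 * n + 2)), ∀ x,
      ‖(B₂ s).adjoint x‖ ^ 2 ≤ K n * ‖x‖ ^ 2)
    (hτ : ∀ n, τ ≤ t (2 * n + 1) - t (2 * n)) (hτ' : ∀ n, t (2 * n + 2) - t (2 * n + 1) ≤ τ)
    (P : ℝ) (hP : ∀ n, t (2 * n + 2) - t (2 * n) ≤ P)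
    (d : ℕ → ℝ) (hd : ∀ n, 0 ≤ d n)
    (hobs : ∀ n, Observable A B₁ (t (2 * n)) (t (2 * n + 1)) (t (2 * n + 1) - t (2 * n)) (d n))
    (q : ℝ) (hq : q < 1)
    (hdq : ∀ n, Real.exp (K n * (t (2 * n + 2) - t (2 * n + 1))) * (d n / (d n + 1) + 1) - 1 ≤ q) :
    ∃ γ > 0, ∃ μ > 0, ∀ (u : ℝ → A.V) (v : ℝ → H), IsSol A B₁ B₂ τ t u v →
      ∀ s > 0, A.energy (u s) (v s) ≤ γ * Real.exp (-μ * s) * A.energy (u 0) (v 0) := by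
  have hlt : ∀ n, t n < t (n + 1) := fun n => ht n.lt_succ_self
  have hτ0 : 0 < τ := (sub_pos.2 (hlt _)).trans_le (hτ' 0)
  have hP0 : 0 < P := (sub_pos.2 (ht (by lia))).trans_le (hP 0)
  have hq0 : 0 ≤ q := by
    have hexp := Real.one_le_exp (mul_nonneg (hK0 0) (sub_pos.2 (hlt (2 * 0 + 1))).le)
    have hd0 : 0 ≤ d 0 / (d 0 + 1) := div_nonneg (hd 0) (by linarith [hd 0])
    linarith [hdq 0, one_le_mul_of_one_le_of_one_le hexp (le_add_of_nonneg_left hd0)]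
  obtain ⟨q', hqq', hq'⟩ := exists_between hq
  refine ⟨q'⁻¹, inv_pos.2 (hq0.trans_lt hqq'), -Real.log q' / P,
    div_pos (neg_pos.2 (Real.log_neg (hq0.trans_lt hqq') hq')) hP0, fun u v hsol s hs => ?_⟩
  obtain ⟨g, hdamp, hdelay⟩ := hsol.exists_isDampedSol_isWeakSol ht0 ht.monotone
    (by simpa [ht0] using hτ 0) hB₂ hB₁ hadm hreg
  have hcycle : ∀ n, ∀ r ∈ Icc (t (2 * n + 1)) (t (2 * n + 2)),
      A.energy (u r) (v r) ≤ q' * A.energy (u (t (2 * n))) (v (t (2 * n))) := fun n r hr =>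
    (energy_le_of_cycle (hlt _) (hlt _) (hτ n) (hτ' n) (hdamp n) (hdelay n) (hadm n).graph
      (hreg n) (hK0 n) (hK n) (hd n) (hobs n) hr).trans
      (mul_le_mul_of_nonneg_right ((hdq n).trans hqq'.le) (A.energy_nonneg _ _))
  refine le_exp_mul_of_contraction (e := fun r => A.energy (u r) (v r)) (T := fun n => t (2 * n))
    (hq0.trans_lt hqq') hq' hP0 ht0 (fun m n hmn => ht.monotone (by lia)) hP
    (not_bddAbove_range_of_le_sub hτ0 fun n =>
      (hτ n).trans (sub_le_sub_right (hlt (2 * n + 1)).le _))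
    (fun n r hr => ?_) (fun n => hcycle n _ (right_mem_Icc.2 (hlt _).le)) (A.energy_nonneg _ _)
    hs.le
  rcases le_total r (t (2 * n + 1)) with hle | hle
  · exact (hdamp n).energy_le (hlt _) (hadm n).graph ⟨hr.1, hle⟩
  · exact (hcycle n r ⟨hle, hr.2⟩).trans (mul_le_of_le_one_left (A.energy_nonneg _ _) hq'.le)

theorem theorem4p4
    {H : Type*} [NormedAddCommGroup H] [InnerProductSpace ℝ H] [CompleteSpace H]
    {U₁ : Type*} [NormedAddCommGroup U₁] [InnerProductSpace ℝ U₁] [CompleteSpace U₁]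
    {U₂ : Type*} [NormedAddCommGroup U₂] [InnerProductSpace ℝ U₂] [CompleteSpace U₂]
    {W : Type*} [NormedAddCommGroup W] [InnerProductSpace ℝ W] [CompleteSpace W]
    -- the operator `A`, the damping operators, the delay, the switching times
    (A : PosOp H) (B₁ : ℝ → U₁ →L[ℝ] StrongDual ℝ A.V) (B₂ : ℝ → U₂ →L[ℝ] H)
    (τ : ℝ) (hτ : 0 < τ)
    (t : ℕ → ℝ) (ht0 : t 0 = 0) (ht : StrictMono t)
    (hB₂ : ∀ n, ∀ s ∈ Ico (t (2 * n)) (t (2 * n + 1)), B₂ s = 0)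
    (hB₁ : ∀ n, ∀ s ∈ Ico (t (2 * n + 1)) (t (2 * n + 2)), B₁ s = 0)
    (hB₁reg : ∀ n, RegularB₁ A B₁ (t (2 * n)) (t (2 * n + 1)))
    (hB₂reg : ∀ n, RegularB₂ B₂ (t (2 * n + 1)) (t (2 * n + 2)))
    -- the continuous embeddings `H → W` and `V → U₁`, and the bounds on `B₁*`, `B₂*`
    (k : H →L[ℝ] W) (C : ℝ) (hC : 0 < C) (hk : ∀ x, ‖k x‖ ^ 2 ≤ C * ‖x‖ ^ 2)
    (j : A.V →L[ℝ] U₁) (m M : ℕ → ℝ)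
    (hm : ∀ n, 0 < m (2 * n)) (hmM : ∀ n, m (2 * n) ≤ M (2 * n))
    (hM : ∀ n, 0 < M (2 * n + 1))
    (h_i : ∀ n, ∀ s ∈ Ico (t (2 * n)) (t (2 * n + 1)), ∀ x : A.V,
      m (2 * n) * ‖j x‖ ^ 2 ≤ ‖dualOp (B₁ s) x‖ ^ 2 ∧
        ‖dualOp (B₁ s) x‖ ^ 2 ≤ M (2 * n) * ‖j x‖ ^ 2)
    (h_ii : ∀ n, ∀ s ∈ Ico (t (2 * n + 1)) (t (2 * n + 2)), ∀ x : H,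
      ‖(B₂ s).adjoint x‖ ^ 2 ≤ M (2 * n + 1) * ‖k x‖ ^ 2)
    -- the lengths of the intervals
    (Tstar Ttilde : ℝ) (hTs : ∀ n, t (2 * n + 1) - t (2 * n) = Tstar)
    (hTt : ∀ n, t (2 * n + 2) - t (2 * n + 1) = Ttilde)
    (hTsτ : τ ≤ Tstar) (hTtτ : Ttilde ≤ τ)
    -- the observability inequality for the damped system
    (Tbar : ℕ → ℝ) (hTbar : ∀ n, 0 ≤ Tbar n ∧ Tbar n < Tstar)
    (d : ℕ → ℝ → ℝ) (hd : ∀ n, ∀ T ∈ Ioc (Tbar n) Tstar, 0 ≤ d n T)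
    (hobs : ∀ n, ∀ T ∈ Ioc (Tbar n) Tstar,
      Observable A B₁ (t (2 * n)) (t (2 * n + 1)) T (d n T))
    -- the smallness condition, with `d n Tstar / (d n Tstar + 1)` as contraction constant on `[t (2n), t (2n+1)]`
    (hbdd : BddAbove (range fun n =>
      Real.exp (C * M (2 * n + 1) * Ttilde) * (d n Tstar / (d n Tstar + 1) + 1) - 1))
    (hsup : ⨆ n, (Real.exp (C * M (2 * n + 1) * Ttilde) *
      (d n Tstar / (d n Tstar + 1) + 1) - 1) < 1) :
    ∃ γ > 0, ∃ μ > 0, ∀ (u : ℝ → A.V) (v : ℝ → H), IsSol A B₁ B₂ τ t u v →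
      ∀ s > 0, A.energy (u s) (v s) ≤ γ * Real.exp (-μ * s) * A.energy (u 0) (v 0) := by
  have hT : ∀ n, Tstar ∈ Ioc (Tbar n) Tstar := fun n => ⟨(hTbar n).2, le_rfl⟩
  exact theorem4p4_general A B₁ B₂ τ t ht0 ht hB₂ hB₁ (fun n => (hB₁reg n).admissibleDamping)
    hB₂reg (fun n => C * M (2 * n + 1)) (fun n => (mul_pos hC (hM n)).le)
    (fun n s hs x => (h_ii n s hs x).trans <|
      (mul_le_mul_of_nonneg_left (hk x) (hM n).le).trans_eq (by ring))
    (fun n => hTsτ.trans_eq (hTs n).symm) (fun n => (hTt n).trans_le hTtτ)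
    (Tstar + Ttilde) (fun n => by linarith [hTs n, hTt n]) (fun n => d n Tstar)
    (fun n => hd n Tstar (hT n)) (fun n => (hTs n).symm ▸ hobs n Tstar (hT n)) _ hsup
    (fun n => by rw [hTt n]; exact le_ciSup hbdd n)
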